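/- **Setting.** Let $X_1,\dots,X_n\in\mathbb{R}^d$, $Y\in\mathbb{R}^n$, and let $\mathcal{D}\subset\mathbb{R}^d$ be a nonempty closed convex set. Put $A=e_n\otimes I_n-I_n\otimes e_n\in\mathbb{R}^{n^2\times n}$ and $B=\mathrm{Diag}(B_1,\dots,B_n)\in\mathbb{R}^{n^2\times dn}$ with $B_i=e_nX_i^T-X^T$, $X=(X_1,\dots,X_n)$. For $\xi=(\xi_1;\dots;\xi_n)\in\mathbb{R}^{dn}$ let $p(\xi)=\sum_{i=1}^n\delta_{\mathcal{D}}(\xi_i)$, and let $\delta_+$ and $\Pi_+$ be the indicator function of, and the projection onto, $\mathbb{R}^{n^2}_+$. Consider $$\text{(P)}\quad \min_{\theta\in\mathbb{R}^n,\ \xi\in\mathbb{R}^{dn}}\ \tfrac12\|\theta-Y\|^2+p(\xi)+\delta_+(A\theta+B\xi),$$ $$\text{(D)}\quad \max_{u\in\mathbb{R}^{n^2},\ v\in\mathbb{R}^{dn}}\ -\tfrac12\|A^Tu\|^2-\langle Y,A^Tu\rangle-p^*(-v)-\delta_+(u)\quad\text{s.t. } B^Tu+v=0,$$ with the KKT conditions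 $$\theta-Y-A^Tu=0,\quad B^Tu+v=0,\quad -v\in\partial p(\xi),\quad -u\in\partial\delta_+(A\theta+B\xi).$$ Let $l(\theta,\xi;u,v)=\tfrac12\|\theta-Y\|^2-p^*(-v)-\langle v,\xi\rangle-\delta_+(u)-\langle u,A\theta+B\xi\rangle$ be the Lagrangian, $\mathcal{T}_l(\theta,\xi,u,v)=\{(\theta',\xi',u',v')\mid(\theta',\xi',-u',-v')\in\partial l(\theta,\xi,u,v)\}$ (convex subgradients in $(\theta,\xi)$, concave supergradients in $(u,v)$), and $\Lambda:=\mathcal{T}_l^{-1}(0)$. With the Moreau envelope $\mathrm{E}_q(x)=\min_y\{q(y)+\tfrac12\|y-x\|^2\}$ and its minimizer $\mathrm{Prox}_q(x)$, the augmented Lagrangian is, for $\sigma>0$, $$\mathcal{L}_\sigma(\theta,\xi;u,v)=\tfrac12\|\theta-Y\|^2+\sigma \mathrm{E}_p(\xi-\tfrac v\sigma)+\sigma \mathrm{E}_{\delta_+}(A\theta+B\xi-\tfrac u\sigma)-\tfrac1{2\sigma}\|u\|^2-\tfrac1{2\sigma}\|v\|^2 .$$ **Algorithm.** Let $H_1\in\mathbb{R}^{n\times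 n}$, $H_2\in\mathbb{R}^{dn\times dn}$ be symmetric positive definite, $\varepsilon_k\ge0$ summable, $0<\sigma_0\le\sigma_1\le\cdots$ with $\sigma_k\uparrow\sigma_\infty\le\infty$. Put $\Sigma=\mathrm{Diag}(H_1,H_2,I_{n^2},I_{dn})$, $\|z\|_\Sigma=\sqrt{\langle z,\Sigma z\rangle}$, $\mathrm{dist}_\Sigma(z,C)=\inf_{w\in C}\|z-w\|_\Sigma$, $\lambda_{\min}=\min\{\lambda_{\min}(H_1),\lambda_{\min}(H_2),1\}$, $\lambda_{\max}=\max\{\lambda_{\max}(H_1),\lambda_{\max}(H_2),1\}$. Let $z^k=(\theta^k,\xi^k,u^k,v^k)$, $k\ge0$, be an infinite sequence, with arbitrary $z^0$, such that for every $k\ge 0$, with $\Phi_k(\theta,\xi)=\mathcal{L}_{\sigma_k}(\theta,\xi;u^k,v^k)+\tfrac1{2\sigma_k}\|\theta-\theta^k\|_{H_1}^2+\tfrac1{2\sigma_k}\|\xi-\xi^k\|_{H_2}^2$, $$\text{(A)}\quad\|\nabla\Phi_k(\theta^{k+1},\xi^{k+1})\|\le\frac{\sqrt{\lambda_{\min}}}{\sigma_k}\varepsilon_k,$$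 $$u^{k+1}=-\sigma_k\big[A\theta^{k+1}+B\xi^{k+1}-u^k/\sigma_k-\Pi_+(A\theta^{k+1}+B\xi^{k+1}-u^k/\sigma_k)\big],$$ $$v^{k+1}=-\sigma_k\big[\xi^{k+1}-v^k/\sigma_k-\mathrm{Prox}_p(\xi^{k+1}-v^k/\sigma_k)\big].$$ **Theorem.** Suppose that the solution set of the KKT conditions is nonempty. This set is exactly $\Lambda$, and the following hold. (1) The sequence $\{z^k\}$ is bounded, $\{(\theta^k,\xi^k)\}$ converges to an optimal solution of (P), and $\{(u^k,v^k)\}$ converges to an optimal solution of (D). (2) Let $r:=\sum_{k=0}^\infty\varepsilon_k+\mathrm{dist}_\Sigma(z^0,\Lambda)$. Assume that there is $\kappa>0$ such that $\mathrm{dist}(z,\Lambda)\le\kappa\,\mathrm{dist}(0,\mathcal{T}_l(z))$ for all $z$ with $\mathrm{dist}(z,\Lambda)\le r$ (where $\mathrm{dist}(0,\emptyset)=+\infty$), and that, in addition to (A), for all $k\ge 0$, $$\text{(B)}\quad\|\nabla\Phi_k(\theta^{k+1},\xi^{k+1})\|\le\frac{\delta_k\sqrt{\lambda_{\min}}}{\sigma_k}\|z^{k+1}-z^k\|_\Sigma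 ,$$ where $0\le\delta_k<1$ and $\sum_k\delta_k<\infty$. Then for all $k\ge0$ $$\mathrm{dist}_\Sigma(z^{k+1},\Lambda)\le\mu_k\,\mathrm{dist}_\Sigma(z^k,\Lambda),$$ where $$\mu_k=\frac1{1-\delta_k}\Big(\delta_k+\frac{(1+\delta_k)\kappa\lambda_{\max}}{\sqrt{\sigma_k^2+\kappa^2\lambda_{\max}^2}}\Big)\ \longrightarrow\ \mu_\infty=\frac{\kappa\lambda_{\max}}{\sqrt{\sigma_\infty^2+\kappa^2\lambda_{\max}^2}}<1$$ (read $\mu_\infty=0$ if $\sigma_\infty=\infty$). Moreover $\mu_\infty\to0$ as $\sigma_\infty\to\infty$. -/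

import Mathlib

open Filter Topology

noncomputable section

namespace ProxALM

/-! ### Extended-valued convex analysis -/

section Convex

variable {E : Type*} [NormedAddCommGroup E] [InnerProductSpace ℝ E]

open Classical in
/-- The indicator function `δ_C` of a set: `0` on `C` and `+∞` elsewhere. -/
def ind (C : Set E) (x : E) : EReal := if x ∈ C then 0 else ⊤

/-- The convex conjugate `q*(z) = sup_x (⟨x, z⟩ - q x)`. -/
def conj (q : E → EReal) (z : E) : EReal := ⨆ x : E, ((inner ℝ x z : ℝ) : EReal) - q x

/-- The convex subdifferential of an extended-valued function. -/
def subdiff (q : E → EReal) (x : E) : Set E :=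
  {g | ∀ y : E, q x + ((inner ℝ g (y - x) : ℝ) : EReal) ≤ q y}

/-- The objective `y ↦ q y + ½‖y - x‖²` that defines the Moreau envelope at `x`. -/
def proxObj (q : E → EReal) (x y : E) : EReal := q y + ((1 / 2 * ‖y - x‖ ^ 2 : ℝ) : EReal)

/-- The Moreau envelope `E_q(x) = min_y (q y + ½‖y - x‖²)`, which is finite-valued for
closed proper convex `q`. -/
def moreau (q : E → EReal) (x : E) : ℝ := (⨅ y : E, proxObj q x y).toReal

/-- The proximal mapping: the minimizer of `y ↦ q y + ½‖y - x‖²`, which exists and is unique for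
closed proper convex `q`. -/
def prox (q : E → EReal) (x : E) : E :=
  Classical.epsilon fun y : E => ∀ y' : E, proxObj q x y ≤ proxObj q x y'

end Convex

/-! ### Spaces -/

/-- The space `ℝⁿ` of `θ`. -/
abbrev ThetaSp (n : ℕ) := EuclideanSpace ℝ (Fin n)

/-- The space `ℝ^{dn}` of `ξ = (ξ₁; …; ξₙ)`; the entry `(i, j)` is the `j`-th entry of `ξᵢ`. -/
abbrev XiSp (n d : ℕ) := EuclideanSpace ℝ (Fin n × Fin d)

/-- The space `ℝ^{n²}` of `u`. -/
abbrev USp (n : ℕ) := EuclideanSpace ℝ (Fin n × Fin n)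

/-- Pairs `(θ, ξ)` with the Euclidean norm. -/
abbrev Primal (n d : ℕ) := WithLp 2 (ThetaSp n × XiSp n d)

/-- Pairs `(u, v)` with the Euclidean norm. -/
abbrev Dual (n d : ℕ) := WithLp 2 (USp n × XiSp n d)

/-- Quadruples `(θ, ξ, u, v) = ((θ, ξ), (u, v))` with the Euclidean norm. -/
abbrev PD (n d : ℕ) := WithLp 2 (Primal n d × Dual n d)

/-- A matrix acting on Euclidean space. -/
abbrev act {ι κ : Type*} [Fintype κ] [DecidableEq κ] (M : Matrix ι κ ℝ)
    (x : EuclideanSpace ℝ κ) : EuclideanSpace ℝ ι := Matrix.toEuclideanLin M x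

/-- The nonnegative orthant `ℝ₊^{n²}`. -/
def orthant (n : ℕ) : Set (USp n) := {w | ∀ i, 0 ≤ w i}

/-! ### The primal and dual problems -/

/-- Data of the shape-constrained regression problem: design points `X₁, …, Xₙ ∈ ℝᵈ`, responses
`Y ∈ ℝⁿ` and the constraint set `D ⊆ ℝᵈ`. -/
structure Data (n d : ℕ) where
  X : Fin n → EuclideanSpace ℝ (Fin d)
  Y : ThetaSp n
  D : Set (EuclideanSpace ℝ (Fin d))

/-- `A = eₙ ⊗ Iₙ - Iₙ ⊗ eₙ`; row `(i, j)` sends `θ` to `θⱼ - θᵢ`. -/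
def matA (n : ℕ) : Matrix (Fin n × Fin n) (Fin n) ℝ :=
  Matrix.of fun r c => (if r.2 = c then 1 else 0) - (if r.1 = c then 1 else 0)

/-- The `i`-th block `ξᵢ ∈ ℝᵈ` of `ξ`. -/
def block {n d : ℕ} (ξ : XiSp n d) (i : Fin n) : EuclideanSpace ℝ (Fin d) :=
  WithLp.toLp 2 fun j => ξ (i, j)

namespace Data

variable {n d : ℕ} (P : Data n d)

/-- `B = Diag(B₁, …, Bₙ)` with `Bᵢ = eₙ Xᵢᵀ - Xᵀ`; row `(i, j)` sends `ξ` to `⟨Xᵢ - Xⱼ, ξᵢ⟩`. -/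
def matB : Matrix (Fin n × Fin n) (Fin n × Fin d) ℝ :=
  Matrix.of fun r c => if r.1 = c.1 then P.X r.1 c.2 - P.X r.2 c.2 else 0

/-- `p(ξ) = ∑ᵢ δ_D(ξᵢ)`. -/
def p (ξ : XiSp n d) : EReal := ∑ i : Fin n, ind P.D (block ξ i)

/-- `Aθ + Bξ`. -/
def cons (x : Primal n d) : USp n := act (matA n) x.fst + act P.matB x.snd

/-- The objective of (P): `½‖θ - Y‖² + p(ξ) + δ₊(Aθ + Bξ)`. -/
def primalObj (x : Primal n d) : EReal :=
  ((1 / 2 * ‖x.fst - P.Y‖ ^ 2 : ℝ) : EReal) + P.p x.snd + ind (orthant n) (P.cons x)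

/-- `x = (θ, ξ)` is an optimal solution of (P). -/
def IsPrimalOptimal (x : Primal n d) : Prop :=
  P.primalObj x ≠ ⊤ ∧ ∀ x', P.primalObj x ≤ P.primalObj x'

/-- The objective of (D): `-½‖Aᵀu‖² - ⟨Y, Aᵀu⟩ - p*(-v) - δ₊(u)`. -/
def dualObj (y : Dual n d) : EReal :=
  ((-(1 / 2) * ‖act (matA n).transpose y.fst‖ ^ 2
      - inner ℝ P.Y (act (matA n).transpose y.fst) : ℝ) : EReal)
    - conj P.p (-y.snd) - ind (orthant n) y.fst

/-- The constraint `Bᵀu + v = 0` of (D). -/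
def DualConstraint (y : Dual n d) : Prop := act P.matB.transpose y.fst + y.snd = 0

/-- `y = (u, v)` is an optimal solution of (D). -/
def IsDualOptimal (y : Dual n d) : Prop :=
  P.DualConstraint y ∧ P.dualObj y ≠ ⊥ ∧ ∀ y', P.DualConstraint y' → P.dualObj y' ≤ P.dualObj y

/-- The solution set of the KKT conditions
`θ - Y - Aᵀu = 0`, `Bᵀu + v = 0`, `-v ∈ ∂p(ξ)`, `-u ∈ ∂δ₊(Aθ + Bξ)`. -/
def kktSet : Set (PD n d) :=
  {z | z.fst.fst - P.Y - act (matA n).transpose z.snd.fst = 0 ∧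
    act P.matB.transpose z.snd.fst + z.snd.snd = 0 ∧
    -z.snd.snd ∈ subdiff P.p z.fst.snd ∧
    -z.snd.fst ∈ subdiff (ind (orthant n)) (P.cons z.fst)}

/-- The Lagrangian
`l(θ, ξ; u, v) = ½‖θ - Y‖² - p*(-v) - ⟨v, ξ⟩ - δ₊(u) - ⟨u, Aθ + Bξ⟩`. -/
def lagr (x : Primal n d) (y : Dual n d) : EReal :=
  ((1 / 2 * ‖x.fst - P.Y‖ ^ 2 - inner ℝ y.snd x.snd - inner ℝ y.fst (P.cons x) : ℝ) : EReal)
    - conj P.p (-y.snd) - ind (orthant n) y.fst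

/-- The operator `T_l`: `(x', y') ∈ T_l(x, y)` iff `(x', -y') ∈ ∂l(x, y)`, where `∂l` is the
subdifferential of the convex-concave function `l`: the convex subgradients in `x = (θ, ξ)` paired
with the concave supergradients in `y = (u, v)`. -/
def Tl (z : PD n d) : Set (PD n d) :=
  {w | (∀ x, P.lagr z.fst z.snd + ((inner ℝ w.fst (x - z.fst) : ℝ) : EReal) ≤ P.lagr x z.snd) ∧
    (∀ y, P.lagr z.fst y ≤
      P.lagr z.fst z.snd + ((inner ℝ (-w.snd) (y - z.snd) : ℝ) : EReal))}

/-- `Λ = T_l⁻¹(0)`. -/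
def Lam : Set (PD n d) := {z | 0 ∈ P.Tl z}

/-- The augmented Lagrangian
`½‖θ - Y‖² + σ E_p(ξ - v/σ) + σ E_{δ₊}(Aθ + Bξ - u/σ) - ‖u‖²/(2σ) - ‖v‖²/(2σ)`. -/
def augLagr (σ : ℝ) (x : Primal n d) (y : Dual n d) : ℝ :=
  1 / 2 * ‖x.fst - P.Y‖ ^ 2 + σ * moreau P.p (x.snd - σ⁻¹ • y.snd)
    + σ * moreau (ind (orthant n)) (P.cons x - σ⁻¹ • y.fst)
    - 1 / (2 * σ) * ‖y.fst‖ ^ 2 - 1 / (2 * σ) * ‖y.snd‖ ^ 2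

end Data

/-! ### Weighted norms, eigenvalues -/

/-- `‖x‖_H = √⟨x, H x⟩`. -/
def wnorm {ι : Type*} [Fintype ι] [DecidableEq ι] (H : Matrix ι ι ℝ)
    (x : EuclideanSpace ℝ ι) : ℝ := √(inner ℝ x (act H x))

/-- The largest eigenvalue of a symmetric matrix. -/
def eigMax {ι : Type*} [Fintype ι] [DecidableEq ι] (H : Matrix ι ι ℝ) : ℝ := sSup (spectrum ℝ H)

/-- The smallest eigenvalue of a symmetric matrix. -/
def eigMin {ι : Type*} [Fintype ι] [DecidableEq ι] (H : Matrix ι ι ℝ) : ℝ := sInf (spectrum ℝ H)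

section Algorithm

variable {n d : ℕ} (P : Data n d)
  (H₁ : Matrix (Fin n) (Fin n) ℝ) (H₂ : Matrix (Fin n × Fin d) (Fin n × Fin d) ℝ)

/-- `λ_max = max{λ_max(H₁), λ_max(H₂), 1}`. -/
def lamMax : ℝ := max (eigMax H₁) (max (eigMax H₂) 1)

/-- `λ_min = min{λ_min(H₁), λ_min(H₂), 1}`. -/
def lamMin : ℝ := min (eigMin H₁) (min (eigMin H₂) 1)

/-- `‖z‖_Σ` for `Σ = Diag(H₁, H₂, I, I)`. -/
def normSig (z : PD n d) : ℝ :=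
  √(inner ℝ z.fst.fst (act H₁ z.fst.fst) + inner ℝ z.fst.snd (act H₂ z.fst.snd)
    + ‖z.snd.fst‖ ^ 2 + ‖z.snd.snd‖ ^ 2)

/-- `dist_Σ(z, C) = inf {‖z - w‖_Σ | w ∈ C}`, for nonempty `C`. -/
def distSig (z : PD n d) (C : Set (PD n d)) : ℝ := ⨅ w : C, normSig H₁ H₂ (z - w)

/-- The subproblem objective `Φ_k` at the current iterate `z` and with penalty `σ`:
`L_σ(θ, ξ; u, v) + ‖θ - θᵏ‖²_{H₁}/(2σ) + ‖ξ - ξᵏ‖²_{H₂}/(2σ)`. -/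
def Phi (σ : ℝ) (z : PD n d) (x : Primal n d) : ℝ :=
  P.augLagr σ x z.snd + 1 / (2 * σ) * wnorm H₁ (x.fst - z.fst.fst) ^ 2
    + 1 / (2 * σ) * wnorm H₂ (x.snd - z.fst.snd) ^ 2

/-- `z` is an infinite sequence of iterates `(θᵏ, ξᵏ, uᵏ, vᵏ)` of the proximal augmented Lagrangian
method with penalties `σ` and tolerances `ε`: the inexact minimization with criterion (A) and the
multiplier updates. -/
structure IsIterates (σ ε : ℕ → ℝ) (z : ℕ → PD n d) : Prop where
  critA : ∀ k, ‖gradient (Phi P H₁ H₂ (σ k) (z k)) (z (k + 1)).fst‖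
    ≤ √(lamMin H₁ H₂) / σ k * ε k
  update_u : ∀ k, (z (k + 1)).snd.fst =
    -(σ k • (P.cons (z (k + 1)).fst - (σ k)⁻¹ • (z k).snd.fst
      - prox (ind (orthant n)) (P.cons (z (k + 1)).fst - (σ k)⁻¹ • (z k).snd.fst)))
  update_v : ∀ k, (z (k + 1)).snd.snd =
    -(σ k • ((z (k + 1)).fst.snd - (σ k)⁻¹ • (z k).snd.snd
      - prox P.p ((z (k + 1)).fst.snd - (σ k)⁻¹ • (z k).snd.snd)))

/-- The stopping criterion (B). -/
def CritB (σ δ : ℕ → ℝ) (z : ℕ → PD n d) : Prop :=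
  ∀ k, ‖gradient (Phi P H₁ H₂ (σ k) (z k)) (z (k + 1)).fst‖
    ≤ δ k * √(lamMin H₁ H₂) / σ k * normSig H₁ H₂ (z (k + 1) - z k)

/-- The error bound condition `dist(z, Λ) ≤ κ dist(0, T_l(z))` whenever `dist(z, Λ) ≤ r`, with the
convention that the distance to the empty set is `+∞`. -/
def ErrorBound (κ r : ℝ) : Prop :=
  ∀ z : PD n d, Metric.infDist z P.Lam ≤ r →
    ENNReal.ofReal (Metric.infDist z P.Lam)
      ≤ ENNReal.ofReal κ * Metric.infEDist (0 : PD n d) (P.Tl z)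

end Algorithm

/-- `μ_k` as a function of `κ`, `λ_max`, `σ_k` and `δ_k`. -/
def mu (κ lam σ δ : ℝ) : ℝ :=
  1 / (1 - δ) * (δ + (1 + δ) * κ * lam / √(σ ^ 2 + κ ^ 2 * lam ^ 2))

/-- `μ_∞ = κ λ_max / √(σ_∞² + κ² λ_max²)`, which is `0` for `σ_∞ = +∞`. -/
def muInf (κ lam : ℝ) (σinf : EReal) : ℝ :=
  if σinf = ⊤ then 0 else κ * lam / √(σinf.toReal ^ 2 + κ ^ 2 * lam ^ 2)

end ProxALM

end

/-!
The method is an inexact proximal point method in disguise. The Lagrangian is that of minimizing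
`½‖θ - Y‖²` subject to `(Aθ + Bξ, ξ) ∈ ℝ₊^{n²} × Dⁿ`, its saddle operator `T_l` is maximal monotone,
and the stationarity of `Φ_k` together with the multiplier updates says that
`σ_k⁻¹ Σ (aᵏ - zᵏ⁺¹) ∈ T_l(zᵏ⁺¹)`, where `Σ (aᵏ - zᵏ) = σ_k (∇Φ_k, 0)` is controlled by the stopping
criteria. Monotonicity gives, for every `w ∈ Λ`,
`‖zᵏ⁺¹ - w‖²_Σ + ‖aᵏ - zᵏ⁺¹‖²_Σ ≤ ‖aᵏ - w‖²_Σ`, hence quasi-Fejér monotonicity with the summable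
errors `ε_k` and convergence of the whole sequence. Under the error bound the second term dominates
a multiple of `dist_Σ(zᵏ⁺¹, Λ)²`, which yields the contraction factor `μ_k`. The error bound is
assumed on a Euclidean neighbourhood of `Λ` of the radius `r` whereas the iterates stay in the
`Σ`-neighbourhood of that radius, which may be larger; outside the Euclidean neighbourhood one gets
`r ≤ κ dist(0, T_l(z))` instead, from the points at distance `r` on a resolvent path towards `Λ`.
-/

noncomputable section

namespace ProxALM

open ContinuousLinearMap (adjoint)

/-! ### Indicator functions, normal cones and projections -/

section Indicator

theorem ind_of_mem {α : Type*} {C : Set α} {x : α} (hx : x ∈ C) : ind C x = 0 := if_pos hx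

theorem ind_of_notMem {α : Type*} {C : Set α} {x : α} (hx : x ∉ C) : ind C x = ⊤ := if_neg hx

/-- The product of two sets in the Euclidean product space. -/
def prodSet {α β : Type*} (C : Set α) (D : Set β) : Set (WithLp 2 (α × β)) :=
  {q | q.fst ∈ C ∧ q.snd ∈ D}

theorem ind_prodSet {α β : Type*} (C : Set α) (D : Set β) (q : WithLp 2 (α × β)) :
    ind (prodSet C D) q = ind C q.fst + ind D q.snd := by
  by_cases h₁ : q.fst ∈ C <;> by_cases h₂ : q.snd ∈ D <;> simp [ind, prodSet, h₁, h₂]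

variable {E : Type*} [NormedAddCommGroup E] {C : Set E} {q : E}

theorem proxObj_ind_of_mem (hq : q ∈ C) (x : E) :
    proxObj (ind C) x q = ((1 / 2 * ‖x - q‖ ^ 2 : ℝ) : EReal) := by
  rw [proxObj, ind_of_mem hq, zero_add, norm_sub_rev]

theorem proxObj_ind_of_notMem (hq : q ∉ C) (x : E) : proxObj (ind C) x q = ⊤ := by
  rw [proxObj, ind_of_notMem hq, EReal.top_add_coe]

end Indicator

section ConvexSets

variable {E : Type*} [NormedAddCommGroup E] [InnerProductSpace ℝ E] {C : Set E}
  {x q q' g g' : E}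

/-- The normal cone of a set at a point, empty at points outside the set. -/
def normalCone (C : Set E) (q : E) : Set E :=
  {g | q ∈ C ∧ ∀ q' ∈ C, inner ℝ g (q' - q) ≤ 0}

/-- The sets whose indicator function is closed, proper and convex. -/
structure IsClosedConvex (C : Set E) : Prop where
  nonempty : C.Nonempty
  isClosed : IsClosed C
  convex : Convex ℝ C

theorem normalCone_monotone (h : g ∈ normalCone C q) (h' : g' ∈ normalCone C q') :
    0 ≤ inner ℝ (g - g') (q - q') := by
  have h₁ := h.2 q' h'.1
  have h₂ := h'.2 q h.1
  rw [← neg_sub, inner_neg_right] at h₁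
  rw [inner_sub_left]
  linarith

theorem smul_mem_normalCone {t : ℝ} (ht : 0 ≤ t) (h : g ∈ normalCone C q) :
    t • g ∈ normalCone C q :=
  ⟨h.1, fun q' hq' => by
    rw [real_inner_smul_left]
    exact mul_nonpos_of_nonneg_of_nonpos ht (h.2 q' hq')⟩

theorem subdiff_ind (hne : C.Nonempty) (x : E) : subdiff (ind C) x = normalCone C x := by
  ext g
  constructor
  · intro h
    have hx : x ∈ C := by
      by_contra hx
      obtain ⟨q, hq⟩ := hne
      simpa [ind_of_notMem hx, ind_of_mem hq] using h q
    refine ⟨hx, fun q hq => ?_⟩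
    have := h q
    rw [ind_of_mem hx, ind_of_mem hq, zero_add] at this
    exact_mod_cast this
  · rintro ⟨hx, h⟩ y
    by_cases hy : y ∈ C
    · rw [ind_of_mem hx, ind_of_mem hy, zero_add]
      exact_mod_cast h y hy
    · rw [ind_of_notMem hy]
      exact le_top

theorem conj_ind_le_iff {t : EReal} :
    conj (ind C) g ≤ t ↔ ∀ q ∈ C, ((inner ℝ q g : ℝ) : EReal) ≤ t := by
  refine iSup_le_iff.trans (forall_congr' fun q => ?_)
  by_cases hq : q ∈ C
  · simp [ind_of_mem hq, hq]
  · simp [ind_of_notMem hq, hq]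

theorem inner_le_conj_ind (hq : q ∈ C) (g : E) :
    ((inner ℝ q g : ℝ) : EReal) ≤ conj (ind C) g :=
  conj_ind_le_iff.1 le_rfl q hq

theorem conj_ind_ne_bot (hne : C.Nonempty) (g : E) : conj (ind C) g ≠ ⊥ :=
  ne_bot_of_le_ne_bot (EReal.coe_ne_bot _) (inner_le_conj_ind hne.some_mem g)

theorem conj_ind_zero (hne : C.Nonempty) : conj (ind C) (0 : E) = 0 :=
  le_antisymm (conj_ind_le_iff.2 fun q _ => by simp)
    (by simpa using inner_le_conj_ind hne.some_mem (0 : E))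

theorem conj_ind_add_le (C : Set E) (g g' : E) :
    conj (ind C) (g + g') ≤ conj (ind C) g + conj (ind C) g' :=
  conj_ind_le_iff.2 fun q hq => by
    rw [inner_add_right, EReal.coe_add]
    exact add_le_add (inner_le_conj_ind hq g) (inner_le_conj_ind hq g')

theorem conj_ind_eq_of_mem_normalCone (h : g ∈ normalCone C q) :
    conj (ind C) g = ((inner ℝ q g : ℝ) : EReal) := by
  refine le_antisymm (conj_ind_le_iff.2 fun q' hq' => ?_) (inner_le_conj_ind h.1 g)
  have := h.2 q' hq'
  rw [inner_sub_right, real_inner_comm, real_inner_comm q g, sub_nonpos] at this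
  exact_mod_cast this

theorem sq_norm_add_sq_norm_le_of_mem_normalCone (h : x - q ∈ normalCone C q) (hq' : q' ∈ C) :
    ‖x - q‖ ^ 2 + ‖q' - q‖ ^ 2 ≤ ‖x - q'‖ ^ 2 := by
  rw [← sub_sub_sub_cancel_right x q' q, norm_sub_sq_real (x - q)]
  linarith [h.2 q' hq']

theorem proxObj_ind_le_of_mem_normalCone (h : x - q ∈ normalCone C q) (q' : E) :
    proxObj (ind C) x q ≤ proxObj (ind C) x q' := by
  by_cases hq' : q' ∈ C
  · rw [proxObj_ind_of_mem h.1, proxObj_ind_of_mem hq', EReal.coe_le_coe_iff]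
    linarith [sq_norm_add_sq_norm_le_of_mem_normalCone h hq', sq_nonneg ‖q' - q‖]
  · exact proxObj_ind_of_notMem hq' x ▸ le_top

theorem moreau_ind_eq_of_mem_normalCone (h : x - q ∈ normalCone C q) :
    moreau (ind C) x = 1 / 2 * ‖x - q‖ ^ 2 := by
  have hmin : ⨅ y, proxObj (ind C) x y = proxObj (ind C) x q :=
    le_antisymm (iInf_le _ q) (le_iInf (proxObj_ind_le_of_mem_normalCone h))
  rw [moreau, hmin, proxObj_ind_of_mem h.1, EReal.toReal_coe]

theorem prox_ind_eq_of_mem_normalCone (h : x - q ∈ normalCone C q) : prox (ind C) x = q := by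
  set p := prox (ind C) x
  have hp : ∀ y, proxObj (ind C) x p ≤ proxObj (ind C) x y :=
    Classical.epsilon_spec (p := fun y => ∀ y', proxObj (ind C) x y ≤ proxObj (ind C) x y')
      ⟨q, proxObj_ind_le_of_mem_normalCone h⟩
  have hle := hp q
  rw [proxObj_ind_of_mem h.1] at hle
  have hpC : p ∈ C := by
    by_contra hpC
    rw [proxObj_ind_of_notMem hpC, top_le_iff] at hle
    exact EReal.coe_ne_top _ hle
  rw [proxObj_ind_of_mem hpC, EReal.coe_le_coe_iff] at hle
  have hpq : ‖p - q‖ ^ 2 ≤ 0 := by linarith [sq_norm_add_sq_norm_le_of_mem_normalCone h hpC]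
  simpa [sub_eq_zero] using hpq

variable [CompleteSpace E]

namespace IsClosedConvex

theorem sub_prox_mem_normalCone (hC : IsClosedConvex C) (x : E) :
    x - prox (ind C) x ∈ normalCone C (prox (ind C) x) := by
  obtain ⟨q, hq, hmin⟩ :=
    exists_norm_eq_iInf_of_complete_convex hC.nonempty hC.isClosed.isComplete hC.convex x
  have h : x - q ∈ normalCone C q :=
    ⟨hq, (norm_eq_iInf_iff_real_inner_le_zero hC.convex hq).1 hmin⟩
  exact (prox_ind_eq_of_mem_normalCone h).symm ▸ h

theorem prox_mem (hC : IsClosedConvex C) (x : E) : prox (ind C) x ∈ C :=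
  (hC.sub_prox_mem_normalCone x).1

theorem moreau_ind_eq (hC : IsClosedConvex C) (x : E) :
    moreau (ind C) x = 1 / 2 * ‖x - prox (ind C) x‖ ^ 2 :=
  moreau_ind_eq_of_mem_normalCone (hC.sub_prox_mem_normalCone x)

theorem moreau_ind_le (hC : IsClosedConvex C) (x y : E) :
    moreau (ind C) y ≤ moreau (ind C) x + inner ℝ (x - prox (ind C) x) (y - x)
      + 1 / 2 * ‖y - x‖ ^ 2 := by
  have h := sq_norm_add_sq_norm_le_of_mem_normalCone (hC.sub_prox_mem_normalCone y) (hC.prox_mem x)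
  rw [← sub_add_sub_cancel y x (prox (ind C) x), norm_add_sq_real (y - x),
    real_inner_comm (x - prox (ind C) x)] at h
  rw [hC.moreau_ind_eq, hC.moreau_ind_eq]
  linarith [sq_nonneg ‖prox (ind C) x - prox (ind C) y‖]

theorem inner_sub_prox_sub_nonneg (hC : IsClosedConvex C) (x y : E) :
    0 ≤ inner ℝ ((y - prox (ind C) y) - (x - prox (ind C) x)) (y - x) := by
  have h := normalCone_monotone (hC.sub_prox_mem_normalCone y) (hC.sub_prox_mem_normalCone x)
  have e : y - x = (prox (ind C) y - prox (ind C) x)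
      + ((y - prox (ind C) y) - (x - prox (ind C) x)) := by abel
  rw [e, inner_add_right, real_inner_self_eq_norm_sq]
  positivity

end IsClosedConvex

theorem hasGradientAt_of_abs_sub_le {f : E → ℝ} {c : ℝ}
    (h : ∀ y, |f y - f x - inner ℝ g (y - x)| ≤ c * ‖y - x‖ ^ 2) : HasGradientAt f g x := by
  rw [hasGradientAt_iff_isLittleO]
  refine (Asymptotics.IsBigO.of_bound c (g := fun y => ‖y - x‖ ^ 2)
    (Eventually.of_forall fun y => by simpa using h y)).trans_isLittleO ?_
  have hx : Tendsto (fun y => ‖y - x‖) (𝓝 x) (𝓝 0) := by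
    simpa using (by fun_prop : Continuous fun y => ‖y - x‖).tendsto x
  exact ((Asymptotics.isLittleO_pow_id (𝕜 := ℝ) one_lt_two).comp_tendsto hx).of_norm_right

namespace IsClosedConvex

theorem hasGradientAt_moreau_ind (hC : IsClosedConvex C) (x : E) :
    HasGradientAt (moreau (ind C)) (x - prox (ind C) x) x := by
  refine hasGradientAt_of_abs_sub_le (c := 1 / 2) fun y => abs_le.2 ⟨?_, ?_⟩
  · have hyx := hC.moreau_ind_le y x
    have hmono := hC.inner_sub_prox_sub_nonneg x y
    rw [← neg_sub y x, inner_neg_right, norm_neg] at hyx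
    rw [inner_sub_left] at hmono
    linarith
  · linarith [hC.moreau_ind_le x y]

theorem mem_of_forall_le_conj_ind (hC : IsClosedConvex C) {c : ℝ}
    (hg : conj (ind C) g = c)
    (h : ∀ g', ((c + inner ℝ q (g' - g) : ℝ) : EReal) ≤ conj (ind C) g') : q ∈ C := by
  set p := prox (ind C) q
  have hp : q - p ∈ normalCone C p := hC.sub_prox_mem_normalCone q
  have hle := (h _).trans (conj_ind_add_le C g (q - p))
  rw [hg, conj_ind_eq_of_mem_normalCone hp, add_sub_cancel_left] at hle
  have hle' : c + inner ℝ q (q - p) ≤ c + inner ℝ p (q - p) := by exact_mod_cast hle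
  have hqp : inner ℝ (q - p) (q - p) ≤ 0 := by
    rw [inner_sub_left]
    linarith
  rw [real_inner_self_nonpos, sub_eq_zero] at hqp
  exact hqp ▸ hp.1

theorem mem_normalCone_iff_conj (hC : IsClosedConvex C) {c : ℝ} (hg : conj (ind C) g = c) :
    g ∈ normalCone C q ↔
      ∀ g', ((c + inner ℝ q (g' - g) : ℝ) : EReal) ≤ conj (ind C) g' := by
  constructor
  · intro h g'
    rw [conj_ind_eq_of_mem_normalCone h, EReal.coe_eq_coe_iff] at hg
    rw [inner_sub_right, hg, add_sub_cancel]
    exact inner_le_conj_ind h.1 g'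
  · intro h
    refine ⟨hC.mem_of_forall_le_conj_ind hg h, fun q' hq' => ?_⟩
    have h₀ := h 0
    rw [conj_ind_zero hC.nonempty, zero_sub, inner_neg_right] at h₀
    have h₀' : c + -inner ℝ q g ≤ 0 := by exact_mod_cast h₀
    have hq'g := inner_le_conj_ind hq' g
    rw [hg, EReal.coe_le_coe_iff] at hq'g
    rw [real_inner_comm, inner_sub_left]
    linarith

end IsClosedConvex

end ConvexSets

section Products

variable {E F : Type*} [NormedAddCommGroup E] [InnerProductSpace ℝ E]
  [NormedAddCommGroup F] [InnerProductSpace ℝ F] {C : Set E} {D : Set F}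

theorem mem_normalCone_prodSet_iff {g q : WithLp 2 (E × F)} :
    g ∈ normalCone (prodSet C D) q ↔
      g.fst ∈ normalCone C q.fst ∧ g.snd ∈ normalCone D q.snd := by
  refine ⟨fun h => ⟨⟨h.1.1, fun a ha => ?_⟩, ⟨h.1.2, fun b hb => ?_⟩⟩,
    fun ⟨h₁, h₂⟩ => ⟨⟨h₁.1, h₂.1⟩, fun q' hq' => ?_⟩⟩
  · simpa [WithLp.prod_inner_apply] using h.2 (WithLp.toLp 2 (a, q.snd)) ⟨ha, h.1.2⟩
  · simpa [WithLp.prod_inner_apply] using h.2 (WithLp.toLp 2 (q.fst, b)) ⟨h.1.1, hb⟩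
  · rw [WithLp.prod_inner_apply]
    exact add_nonpos (h₁.2 _ hq'.1) (h₂.2 _ hq'.2)

theorem conj_ind_prodSet (C : Set E) (D : Set F) (g : WithLp 2 (E × F)) :
    conj (ind (prodSet C D)) g = conj (ind C) g.fst + conj (ind D) g.snd := by
  refine le_antisymm (conj_ind_le_iff.2 fun q hq => ?_)
    (EReal.add_le_of_forall_lt fun a ha b hb => ?_)
  · rw [WithLp.prod_inner_apply, EReal.coe_add]
    exact add_le_add (inner_le_conj_ind hq.1 _) (inner_le_conj_ind hq.2 _)
  · obtain ⟨p, hp, hap⟩ : ∃ p ∈ C, a < ((inner ℝ p g.fst : ℝ) : EReal) := by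
      by_contra! h
      exact ha.not_ge (conj_ind_le_iff.2 h)
    obtain ⟨q, hq, hbq⟩ : ∃ q ∈ D, b < ((inner ℝ q g.snd : ℝ) : EReal) := by
      by_contra! h
      exact hb.not_ge (conj_ind_le_iff.2 h)
    refine (add_le_add hap.le hbq.le).trans ?_
    have := inner_le_conj_ind (C := prodSet C D) (q := WithLp.toLp 2 (p, q)) ⟨hp, hq⟩ g
    rwa [WithLp.prod_inner_apply, EReal.coe_add] at this

namespace IsClosedConvex

theorem prodSet (hC : IsClosedConvex C) (hD : IsClosedConvex D) :
    IsClosedConvex (ProxALM.prodSet C D) where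
  nonempty := ⟨WithLp.toLp 2 (hC.nonempty.some, hD.nonempty.some),
    hC.nonempty.some_mem, hD.nonempty.some_mem⟩
  isClosed := (hC.isClosed.preimage (by fun_prop)).inter (hD.isClosed.preimage (by fun_prop))
  convex := fun _ hx _ hy _ _ ha hb hab =>
    ⟨hC.convex hx.1 hy.1 ha hb hab, hD.convex hx.2 hy.2 ha hb hab⟩

variable [CompleteSpace E] [CompleteSpace F]

theorem prox_ind_prodSet (hC : IsClosedConvex C) (hD : IsClosedConvex D)
    (x : WithLp 2 (E × F)) :
    prox (ind (ProxALM.prodSet C D)) x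
      = WithLp.toLp 2 (prox (ind C) x.fst, prox (ind D) x.snd) :=
  prox_ind_eq_of_mem_normalCone (mem_normalCone_prodSet_iff.2
    ⟨hC.sub_prox_mem_normalCone x.fst, hD.sub_prox_mem_normalCone x.snd⟩)

theorem moreau_ind_prodSet (hC : IsClosedConvex C) (hD : IsClosedConvex D)
    (x : WithLp 2 (E × F)) :
    moreau (ind (ProxALM.prodSet C D)) x
      = moreau (ind C) x.fst + moreau (ind D) x.snd := by
  rw [(hC.prodSet hD).moreau_ind_eq, hC.moreau_ind_eq, hD.moreau_ind_eq, hC.prox_ind_prodSet hD,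
    WithLp.prod_norm_sq_eq_of_L2]
  exact mul_add _ _ _

end IsClosedConvex

end Products

/-! ### Maximal monotone operators -/

/-- The set of zeros of a set-valued operator. -/
def zeros {V : Type*} [Zero V] (T : V → Set V) : Set V := {z | 0 ∈ T z}

theorem mem_zeros {V : Type*} [Zero V] {T : V → Set V} {z : V} : z ∈ zeros T ↔ 0 ∈ T z := Iff.rfl

section MaximalMonotone

variable {V : Type*} [NormedAddCommGroup V] [InnerProductSpace ℝ V] {T : V → Set V}
  {x x' y y' z w g h : V} {η t κ r : ℝ}

/-- Maximal monotone operators on a Hilbert space, in the form of Minty's criterion: monotone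
operators `T` such that `T + η` is onto for every `η > 0`. -/
structure IsMaximalMonotone (T : V → Set V) : Prop where
  inner_nonneg : ∀ ⦃x y g h⦄, g ∈ T x → h ∈ T y → 0 ≤ inner ℝ (g - h) (x - y)
  surjective : ∀ ⦃η : ℝ⦄, 0 < η → ∀ y, ∃ x, y - η • x ∈ T x

/-- The error bound `dist(z, T⁻¹(0)) ≤ κ dist(0, T z)` on the `r`-neighbourhood of `T⁻¹(0)`, stated
for the elements of `T z` so that nothing is claimed where `T z` is empty. -/
def HasErrorBound (T : V → Set V) (κ r : ℝ) : Prop :=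
  ∀ ⦃z g⦄, Metric.infDist z (zeros T) ≤ r → g ∈ T z → Metric.infDist z (zeros T) ≤ κ * ‖g‖

namespace IsMaximalMonotone

theorem mem_of_forall_inner_nonneg (hT : IsMaximalMonotone T)
    (hg : ∀ y h, h ∈ T y → 0 ≤ inner ℝ (g - h) (x - y)) : g ∈ T x := by
  obtain ⟨y, hy⟩ := hT.surjective one_pos (g + x)
  rw [one_smul] at hy
  have hxy := hg y _ hy
  rw [add_sub_assoc, sub_add_cancel_left, inner_neg_left, neg_nonneg, real_inner_self_nonpos,
    sub_eq_zero] at hxy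
  rwa [← hxy, add_sub_cancel_right] at hy

theorem mem_of_tendsto (hT : IsMaximalMonotone T) {xs gs : ℕ → V} (hmem : ∀ k, gs k ∈ T (xs k))
    (hx : Tendsto xs atTop (𝓝 x)) (hg : Tendsto gs atTop (𝓝 g)) : g ∈ T x :=
  hT.mem_of_forall_inner_nonneg fun y h hh =>
    ge_of_tendsto' ((hg.sub_const h).inner (hx.sub_const y)) fun k => hT.inner_nonneg (hmem k) hh

theorem mul_norm_sub_le_of_sub_smul_mem (hT : IsMaximalMonotone T)
    (hx : y - η • x ∈ T x) (hx' : y' - η • x' ∈ T x') : η * ‖x - x'‖ ≤ ‖y - y'‖ := by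
  rcases eq_or_ne x x' with rfl | hne
  · simp
  have hmono := hT.inner_nonneg hx hx'
  rw [sub_sub_sub_comm, ← smul_sub, inner_sub_left, real_inner_smul_left,
    real_inner_self_eq_norm_sq] at hmono
  refine le_of_mul_le_mul_right ?_ (norm_sub_pos_iff.2 hne)
  linarith [real_inner_le_norm (y - y') (x - x')]

theorem exists_continuous_resolvent (hT : IsMaximalMonotone T) (hη : 0 < η) :
    ∃ R : V → V, Continuous R ∧ (∀ y, y - η • R y ∈ T (R y)) ∧
      ∀ y x, y - η • x ∈ T x → R y = x := by
  choose R hR using hT.surjective hη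
  refine ⟨R, ?_, hR, fun y x hx => ?_⟩
  · refine (LipschitzWith.of_dist_le_mul (K := (η⁻¹).toNNReal) fun y y' => ?_).continuous
    rw [dist_eq_norm, dist_eq_norm, Real.coe_toNNReal _ (inv_pos.2 hη).le, le_inv_mul_iff₀ hη]
    exact hT.mul_norm_sub_le_of_sub_smul_mem (hR y) (hR y')
  · have hle := hT.mul_norm_sub_le_of_sub_smul_mem (hR y) hx
    rw [sub_self, norm_zero] at hle
    exact sub_eq_zero.1 (norm_le_zero_iff.1 (nonpos_of_mul_nonpos_right hle hη))

-- The path `t ↦ R (t g + η ((1 - t) w + t z))`, with `R` the inverse of `T + η`, joins `w` to `z`.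
theorem exists_infDist_eq_of_mem_Icc (hT : IsMaximalMonotone T) (hη : 0 < η) (hw : w ∈ zeros T)
    (hg : g ∈ T z) (hr : r ∈ Set.Icc 0 (Metric.infDist z (zeros T))) :
    ∃ t ∈ Set.Icc (0 : ℝ) 1, ∃ x, ∃ h ∈ T x, Metric.infDist x (zeros T) = r ∧
      h - t • g = η • ((1 - t) • w + t • z - x) := by
  obtain ⟨R, hRc, hR, hR_eq⟩ := hT.exists_continuous_resolvent hη
  let γ : ℝ → V := fun t => t • g + η • ((1 - t) • w + t • z)
  have hγ₀ : R (γ 0) = w := hR_eq _ _ (by simpa [γ] using (show 0 ∈ T w from hw))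
  have hγ₁ : R (γ 1) = z := hR_eq _ _ (by simpa [γ] using hg)
  have hcont : Continuous fun t => Metric.infDist (R (γ t)) (zeros T) :=
    (Metric.continuous_infDist_pt _).comp (hRc.comp (by fun_prop))
  obtain ⟨t, ht, htr⟩ := intermediate_value_Icc zero_le_one hcont.continuousOn
    (show r ∈ Set.Icc _ _ by rwa [hγ₀, hγ₁, Metric.infDist_zero_of_mem hw])
  exact ⟨t, ht, R (γ t), _, hR _, htr, by simp only [γ, smul_sub]; abel⟩

theorem sq_norm_sub_smul_le (hT : IsMaximalMonotone T) (hη : 0 < η) (ht : t ∈ Set.Icc (0 : ℝ) 1)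
    (hw : w ∈ zeros T) (hg : g ∈ T z) (hh : h ∈ T x)
    (hx : h - t • g = η • ((1 - t) • w + t • z - x)) :
    ‖h - t • g‖ ^ 2 ≤ η * |inner ℝ g (z - w)| := by
  have hxw : 0 ≤ inner ℝ h (x - w) := by simpa using hT.inner_nonneg hh hw
  have hxz := hT.inner_nonneg hh hg
  have hsum : (1 - t) * inner ℝ h (x - w) + t * inner ℝ (h - g) (x - z)
      = t * (1 - t) * inner ℝ g (z - w) - inner ℝ (h - t • g) ((1 - t) • w + t • z - x) := by
    simp only [inner_sub_left, inner_sub_right, inner_add_right, real_inner_smul_left,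
      real_inner_smul_right]
    ring
  have hsum_nonneg : 0 ≤ (1 - t) * inner ℝ h (x - w) + t * inner ℝ (h - g) (x - z) :=
    add_nonneg (mul_nonneg (sub_nonneg.2 ht.2) hxw) (mul_nonneg ht.1 hxz)
  have hcoef : t * (1 - t) * inner ℝ g (z - w) ≤ |inner ℝ g (z - w)| := by
    refine (le_abs_self _).trans ?_
    rw [abs_mul]
    refine mul_le_of_le_one_left (abs_nonneg _) (abs_le.2 ⟨?_, ?_⟩) <;> nlinarith [ht.1, ht.2]
  calc ‖h - t • g‖ ^ 2 = η * inner ℝ (h - t • g) ((1 - t) • w + t • z - x) := by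
        rw [← real_inner_self_eq_norm_sq, ← real_inner_smul_right, ← hx]
    _ ≤ η * |inner ℝ g (z - w)| := mul_le_mul_of_nonneg_left (by linarith) hη.le

theorem exists_infDist_eq_norm_le (hT : IsMaximalMonotone T) (hη : 0 < η) (hw : w ∈ zeros T)
    (hg : g ∈ T z) (hr : r ∈ Set.Icc 0 (Metric.infDist z (zeros T))) :
    ∃ x, ∃ h ∈ T x, Metric.infDist x (zeros T) = r ∧
      ‖h‖ ≤ ‖g‖ + √(η * |inner ℝ g (z - w)|) := by
  obtain ⟨t, ht, x, h, hh, hxr, hx⟩ := hT.exists_infDist_eq_of_mem_Icc hη hw hg hr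
  refine ⟨x, h, hh, hxr, (norm_le_norm_add_norm_sub' h (t • g)).trans (add_le_add ?_ ?_)⟩
  · rw [norm_smul, Real.norm_of_nonneg ht.1]
    exact mul_le_of_le_one_left (norm_nonneg g) ht.2
  · exact Real.le_sqrt_of_sq_le (hT.sq_norm_sub_smul_le hη ht hw hg hh hx)

end IsMaximalMonotone

theorem HasErrorBound.le_mul_norm_of_le_infDist (hEB : HasErrorBound T κ r)
    (hT : IsMaximalMonotone T) (hκ : 0 ≤ κ) (hne : (zeros T).Nonempty) (hg : g ∈ T z)
    (hr : r ∈ Set.Icc 0 (Metric.infDist z (zeros T))) : r ≤ κ * ‖g‖ := by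
  obtain ⟨w, hw⟩ := hne
  have hlim : Tendsto (fun η : ℝ => κ * (‖g‖ + √(η * |inner ℝ g (z - w)|))) (𝓝[>] 0)
      (𝓝 (κ * ‖g‖)) := by
    have hcont : Continuous fun η : ℝ => κ * (‖g‖ + √(η * |inner ℝ g (z - w)|)) := by fun_prop
    simpa using (hcont.tendsto 0).mono_left nhdsWithin_le_nhds
  refine ge_of_tendsto hlim (eventually_mem_nhdsWithin.mono fun η hη => ?_)
  obtain ⟨x, h, hh, hxr, hle⟩ := hT.exists_infDist_eq_norm_le hη hw hg hr
  calc r = Metric.infDist x (zeros T) := hxr.symm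
    _ ≤ κ * ‖h‖ := hEB hxr.le hh
    _ ≤ _ := mul_le_mul_of_nonneg_left hle hκ

end MaximalMonotone

/-! ### The inexact preconditioned proximal point method -/

section WeightedNorm

variable {V W : Type*} [NormedAddCommGroup V] [InnerProductSpace ℝ V]
  [NormedAddCommGroup W] [InnerProductSpace ℝ W]

theorem infDist_image_le_norm_mul (L : V →L[ℝ] W) (x : V) {C : Set V} (hC : C.Nonempty) :
    Metric.infDist (L x) (L '' C) ≤ ‖L‖ * Metric.infDist x C := by
  have := hC.to_subtype
  rw [Metric.infDist_eq_iInf (s := C), Real.mul_iInf_of_nonneg (norm_nonneg L)]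
  refine le_ciInf fun c => (Metric.infDist_le_dist_of_mem (Set.mem_image_of_mem L c.2)).trans ?_
  rw [dist_eq_norm, dist_eq_norm, ← map_sub]
  exact L.le_opNorm _

variable [CompleteSpace V] [CompleteSpace W]

theorem norm_adjoint_apply_le (L : V →L[ℝ] W) (u : W) : ‖adjoint L u‖ ≤ ‖L‖ * ‖u‖ :=
  (adjoint L).le_of_opNorm_le (adjoint.norm_map L).le u

theorem mul_norm_le_norm_adjoint_apply {L : V →L[ℝ] W} {m : ℝ}
    (hm₀ : 0 ≤ m) (hm : ∀ a, m * ‖a‖ ≤ ‖L a‖) (a : V) : m * ‖L a‖ ≤ ‖adjoint L (L a)‖ := by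
  rcases eq_or_ne (L a) 0 with h | h
  · simp [h]
  refine le_of_mul_le_mul_right ?_ (norm_pos_iff.2 h)
  calc m * ‖L a‖ * ‖L a‖ = m * inner ℝ a (adjoint L (L a)) := by
        rw [ContinuousLinearMap.adjoint_inner_right, real_inner_self_eq_norm_mul_norm, mul_assoc]
    _ ≤ m * (‖a‖ * ‖adjoint L (L a)‖) := by gcongr; exact real_inner_le_norm _ _
    _ ≤ ‖adjoint L (L a)‖ * ‖L a‖ := by
        rw [← mul_assoc, mul_comm]
        exact mul_le_mul_of_nonneg_left (hm a) (norm_nonneg _)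

theorem norm_le_of_norm_adjoint_apply_le {L : V →L[ℝ] W} {m t : ℝ} (hm₀ : 0 ≤ m)
    (hm : ∀ a, m * ‖a‖ ≤ ‖L a‖) (ht : 0 ≤ t) {a : V} (ha : ‖adjoint L (L a)‖ ≤ m * t) :
    ‖L a‖ ≤ t := by
  rcases hm₀.eq_or_lt with h | h
  · rw [← h, zero_mul, norm_le_zero_iff] at ha
    have hLa : inner ℝ (L a) (L a) = (0 : ℝ) := by
      rw [← ContinuousLinearMap.adjoint_inner_right, ha, inner_zero_right]
    rwa [inner_self_eq_zero.1 hLa, norm_zero]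
  · exact le_of_mul_le_mul_left ((mul_norm_le_norm_adjoint_apply hm₀ hm a).trans ha) h

theorem exists_adjoint_apply_eq [FiniteDimensional ℝ V] {L : V →L[ℝ] W}
    (hL : Function.Injective L) (e : V) : ∃ a, adjoint L (L a) = e := by
  refine LinearMap.surjective_of_injective (f := (adjoint L ∘L L).toLinearMap) (fun a b hab => ?_) e
  have hself : inner ℝ (L (a - b)) (L (a - b)) = (0 : ℝ) := by
    have hab' : adjoint L (L a) = adjoint L (L b) := hab
    rw [← ContinuousLinearMap.adjoint_inner_right, map_sub, map_sub, hab', sub_self,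
      inner_zero_right]
  exact hL (sub_eq_zero.1 (by rw [← map_sub]; exact inner_self_eq_zero.1 hself))

end WeightedNorm

section ContractionFactor

variable {κ M σ δ c d p q s t : ℝ}

theorem mul_sqrt_add_sq_le (hσ : 0 ≤ σ) (hc : 0 ≤ c) (hs : 0 ≤ s) (hd : 0 ≤ d)
    (hdq : d ≤ q) (hσd : σ * d ≤ c * p) (hpq : q ^ 2 + p ^ 2 ≤ s ^ 2) :
    d * √(σ ^ 2 + c ^ 2) ≤ c * s := by
  refine le_of_sq_le_sq ?_ (mul_nonneg hc hs)
  have hσd_sq : (σ * d) ^ 2 ≤ (c * p) ^ 2 := by gcongr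
  have hdq_sq : d ^ 2 ≤ q ^ 2 := by gcongr
  calc (d * √(σ ^ 2 + c ^ 2)) ^ 2 = (σ * d) ^ 2 + c ^ 2 * d ^ 2 := by
        rw [mul_pow, Real.sq_sqrt (by positivity)]
        ring
    _ ≤ (c * p) ^ 2 + c ^ 2 * q ^ 2 := by gcongr
    _ = c ^ 2 * (q ^ 2 + p ^ 2) := by ring
    _ ≤ c ^ 2 * s ^ 2 := by gcongr
    _ = (c * s) ^ 2 := by ring

theorem mu_pos (hκ : 0 < κ) (hM : 0 < M) (hδ : δ ∈ Set.Ico 0 1) :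
    0 < mu κ M σ δ := by
  have hδ₀ := hδ.1
  have hδ₁ : 0 < 1 - δ := sub_pos.2 hδ.2
  rw [mu]
  positivity

theorem le_mu_mul_of_mul_sqrt_le (hκ : 0 < κ) (hM : 0 < M)
    (hδ : δ ∈ Set.Ico 0 1) (ht : 0 ≤ t) (hd : d * √(σ ^ 2 + (κ * M) ^ 2) ≤ κ * M * s)
    (hs : (1 - δ) * s ≤ (1 + δ) * t) : d ≤ mu κ M σ δ * t := by
  have hδ₀ := hδ.1
  have hδ₁ : 0 < 1 - δ := sub_pos.2 hδ.2
  rw [mul_pow] at hd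
  set R := √(σ ^ 2 + κ ^ 2 * M ^ 2) with hR
  have : 0 < R := by positivity
  calc d ≤ (1 + δ) * κ * M / R / (1 - δ) * t := by
        rw [div_div, div_mul_eq_mul_div, le_div_iff₀ (by positivity)]
        calc d * (R * (1 - δ)) = d * R * (1 - δ) := by ring
          _ ≤ κ * M * s * (1 - δ) := by gcongr
          _ = κ * M * ((1 - δ) * s) := by ring
          _ ≤ κ * M * ((1 + δ) * t) := by gcongr
          _ = (1 + δ) * κ * M * t := by ring
    _ ≤ mu κ M σ δ * t := by
        rw [mu, one_div, inv_mul_eq_div, ← hR]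
        gcongr
        exact le_add_of_nonneg_left hδ₀

end ContractionFactor

section ProximalPoint

variable {V W : Type*} [NormedAddCommGroup V] [InnerProductSpace ℝ V]
  [NormedAddCommGroup W] [InnerProductSpace ℝ W] {T : V → Set V} {L : V →L[ℝ] W}

section Step

variable {a b w z : V} {σ κ r M δ : ℝ}

-- The error bound controls the Euclidean neighbourhood only; where the weighted distance is at
-- most `r` but the Euclidean one is not, `HasErrorBound.le_mul_norm_of_le_infDist` takes over.
theorem HasErrorBound.infDist_image_le (hEB : HasErrorBound T κ r) (hT : IsMaximalMonotone T)
    (hκ : 0 ≤ κ) (hne : (zeros T).Nonempty) (hM : 1 ≤ M) (hL : ‖L‖ ≤ √M) {g : V} (hg : g ∈ T b)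
    (hr : Metric.infDist (L b) (L '' zeros T) ≤ r) :
    Metric.infDist (L b) (L '' zeros T) ≤ √M * (κ * ‖g‖) := by
  rcases le_total (Metric.infDist b (zeros T)) r with h | h
  · calc Metric.infDist (L b) (L '' zeros T) ≤ ‖L‖ * Metric.infDist b (zeros T) :=
          infDist_image_le_norm_mul L b hne
      _ ≤ √M * (κ * ‖g‖) :=
          mul_le_mul hL (hEB h hg) Metric.infDist_nonneg (Real.sqrt_nonneg M)
  · calc Metric.infDist (L b) (L '' zeros T) ≤ r := hr
      _ ≤ κ * ‖g‖ :=
          hEB.le_mul_norm_of_le_infDist hT hκ hne hg ⟨Metric.infDist_nonneg.trans hr, h⟩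
      _ ≤ √M * (κ * ‖g‖) :=
          le_mul_of_one_le_left (by positivity) (Real.one_le_sqrt.2 hM)

theorem one_sub_mul_norm_le (hδ : 0 ≤ δ) (hba : ‖L (b - w)‖ ≤ ‖L (a - w)‖)
    (haz : ‖L (a - z)‖ ≤ δ * ‖L (b - z)‖) :
    (1 - δ) * ‖L (a - w)‖ ≤ (1 + δ) * ‖L (z - w)‖ := by
  have ha : ‖L (a - w)‖ ≤ ‖L (a - z)‖ + ‖L (z - w)‖ := by
    rw [← sub_add_sub_cancel a z w, map_add]
    exact norm_add_le _ _
  have hb : ‖L (b - z)‖ ≤ ‖L (a - w)‖ + ‖L (z - w)‖ := by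
    rw [← sub_sub_sub_cancel_right b z w, map_sub]
    exact (norm_sub_le _ _).trans (by gcongr)
  linarith [mul_le_mul_of_nonneg_left hb hδ]

end Step

variable [CompleteSpace V] [CompleteSpace W]

section Step

variable {a b w : V} {σ κ r M : ℝ}

theorem sq_norm_add_sq_norm_le_of_mem_zeros (hT : IsMaximalMonotone T) (hσ : 0 < σ)
    (hb : σ⁻¹ • adjoint L (L (a - b)) ∈ T b) (hw : w ∈ zeros T) :
    ‖L (b - w)‖ ^ 2 + ‖L (a - b)‖ ^ 2 ≤ ‖L (a - w)‖ ^ 2 := by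
  have hmono := hT.inner_nonneg hb hw
  rw [sub_zero, real_inner_smul_left, ContinuousLinearMap.adjoint_inner_left] at hmono
  have hinner : 0 ≤ inner ℝ (L (a - b)) (L (b - w)) :=
    nonneg_of_mul_nonneg_right hmono (inv_pos.2 hσ)
  rw [← sub_add_sub_cancel a b w, map_add, norm_add_sq_real]
  linarith

theorem norm_le_of_mem_zeros (hT : IsMaximalMonotone T) (hσ : 0 < σ)
    (hb : σ⁻¹ • adjoint L (L (a - b)) ∈ T b) (hw : w ∈ zeros T) : ‖L (b - w)‖ ≤ ‖L (a - w)‖ :=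
  le_of_sq_le_sq ((le_add_of_nonneg_right (sq_nonneg _)).trans
    (sq_norm_add_sq_norm_le_of_mem_zeros hT hσ hb hw)) (norm_nonneg _)

theorem HasErrorBound.mul_infDist_image_le (hEB : HasErrorBound T κ r) (hT : IsMaximalMonotone T)
    (hκ : 0 ≤ κ) (hne : (zeros T).Nonempty) (hM : 1 ≤ M) (hL : ‖L‖ ≤ √M) (hσ : 0 < σ)
    (hb : σ⁻¹ • adjoint L (L (a - b)) ∈ T b)
    (hr : Metric.infDist (L b) (L '' zeros T) ≤ r) :
    σ * Metric.infDist (L b) (L '' zeros T) ≤ κ * M * ‖L (a - b)‖ := by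
  have hadj : ‖adjoint L (L (a - b))‖ ≤ √M * ‖L (a - b)‖ :=
    (norm_adjoint_apply_le L _).trans (mul_le_mul_of_nonneg_right hL (norm_nonneg _))
  calc σ * Metric.infDist (L b) (L '' zeros T)
      ≤ σ * (√M * (κ * ‖σ⁻¹ • adjoint L (L (a - b))‖)) :=
        mul_le_mul_of_nonneg_left (hEB.infDist_image_le hT hκ hne hM hL hb hr) hσ.le
    _ = κ * √M * ‖adjoint L (L (a - b))‖ := by
        rw [norm_smul, Real.norm_of_nonneg (inv_pos.2 hσ).le]
        field_simp
    _ ≤ κ * √M * (√M * ‖L (a - b)‖) := by gcongr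
    _ = κ * M * ‖L (a - b)‖ := by
        rw [← mul_assoc, mul_assoc κ, Real.mul_self_sqrt (zero_le_one.trans hM)]

end Step

/-- The inexact preconditioned proximal point method for `T` with preconditioner `L† L`: up to an
error `ε k` in the weighted norm `‖L ·‖`, which is absorbed by replacing `z k` with `a k`, the point
`z (k + 1)` is the resolvent of `σ k (L† L)⁻¹ T` at `z k`. -/
structure IsInexactPPA (T : V → Set V) (L : V →L[ℝ] W) (σ ε : ℕ → ℝ) (z a : ℕ → V) : Prop where
  pos : ∀ k, 0 < σ k
  step : ∀ k, (σ k)⁻¹ • adjoint L (L (a k - z (k + 1))) ∈ T (z (k + 1))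
  close : ∀ k, ‖L (a k - z k)‖ ≤ ε k

namespace IsInexactPPA

variable {σ ε : ℕ → ℝ} {z a : ℕ → V} {w : V}

theorem nonneg (h : IsInexactPPA T L σ ε z a) (k : ℕ) : 0 ≤ ε k :=
  (norm_nonneg _).trans (h.close k)

theorem norm_displaced_le (h : IsInexactPPA T L σ ε z a) (w : V) (k : ℕ) :
    ‖L (a k - w)‖ ≤ ‖L (z k - w)‖ + ε k := by
  rw [← sub_add_sub_cancel (a k) (z k) w, map_add, add_comm]
  exact (norm_add_le _ _).trans (by gcongr; exact h.close k)

theorem norm_succ_le (h : IsInexactPPA T L σ ε z a) (hT : IsMaximalMonotone T)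
    (hw : w ∈ zeros T) (k : ℕ) : ‖L (z (k + 1) - w)‖ ≤ ‖L (z k - w)‖ + ε k :=
  (norm_le_of_mem_zeros hT (h.pos k) (h.step k) hw).trans (h.norm_displaced_le w k)

theorem norm_le_tsum_add (h : IsInexactPPA T L σ ε z a) (hT : IsMaximalMonotone T)
    (hε : Summable ε) (hw : w ∈ zeros T) (k : ℕ) :
    ‖L (z k - w)‖ ≤ ∑' j, ε j + ‖L (z 0 - w)‖ := by
  have hsum : ‖L (z k - w)‖ ≤ ∑ j ∈ Finset.range k, ε j + ‖L (z 0 - w)‖ := by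
    induction k with
    | zero => simp
    | succ k ih =>
      rw [Finset.sum_range_succ]
      linarith [h.norm_succ_le hT hw k]
  exact hsum.trans (by gcongr; exact hε.sum_le_tsum _ fun j _ => h.nonneg j)

theorem infDist_le_tsum_add (h : IsInexactPPA T L σ ε z a) (hT : IsMaximalMonotone T)
    (hε : Summable ε) (hne : (zeros T).Nonempty) (k : ℕ) :
    Metric.infDist (L (z k)) (L '' zeros T)
      ≤ ∑' j, ε j + Metric.infDist (L (z 0)) (L '' zeros T) := by
  rw [← sub_le_iff_le_add', Metric.le_infDist (hne.image L)]
  rintro _ ⟨w, hw, rfl⟩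
  rw [sub_le_iff_le_add', dist_eq_norm, ← map_sub]
  refine (Metric.infDist_le_dist_of_mem (Set.mem_image_of_mem L hw)).trans ?_
  rw [dist_eq_norm, ← map_sub]
  exact h.norm_le_tsum_add hT hε hw k

theorem exists_tendsto_norm (h : IsInexactPPA T L σ ε z a) (hT : IsMaximalMonotone T)
    (hε : Summable ε) (hw : w ∈ zeros T) :
    ∃ l, Tendsto (fun k => ‖L (z k - w)‖) atTop (𝓝 l) := by
  have hanti : Antitone fun k => ‖L (z k - w)‖ - ∑ j ∈ Finset.range k, ε j := by
    refine antitone_nat_of_succ_le fun k => ?_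
    rw [Finset.sum_range_succ]
    linarith [h.norm_succ_le hT hw k]
  have hbdd : BddBelow (Set.range fun k => ‖L (z k - w)‖ - ∑ j ∈ Finset.range k, ε j) := by
    refine ⟨-∑' j, ε j, Set.forall_mem_range.2 fun k => ?_⟩
    linarith [hε.sum_le_tsum (Finset.range k) fun j _ => h.nonneg j, norm_nonneg (L (z k - w))]
  exact ⟨_, ((tendsto_atTop_ciInf hanti hbdd).add hε.hasSum.tendsto_sum_nat).congr
    fun k => sub_add_cancel _ _⟩

theorem tendsto_norm_step (h : IsInexactPPA T L σ ε z a) (hT : IsMaximalMonotone T)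
    (hε : Summable ε) (hw : w ∈ zeros T) :
    Tendsto (fun k => ‖L (a k - z (k + 1))‖) atTop (𝓝 0) := by
  obtain ⟨l, hl⟩ := h.exists_tendsto_norm hT hε hw
  have hgap : Tendsto (fun k => (‖L (z k - w)‖ + ε k) ^ 2 - ‖L (z (k + 1) - w)‖ ^ 2) atTop
      (𝓝 0) := by
    simpa using ((hl.add hε.tendsto_atTop_zero).pow 2).sub
      (((tendsto_add_atTop_iff_nat 1).2 hl).pow 2)
  have hsq : Tendsto (fun k => ‖L (a k - z (k + 1))‖ ^ 2) atTop (𝓝 0) := by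
    refine squeeze_zero (fun k => sq_nonneg _) (fun k => ?_) hgap
    have hfejer := sq_norm_add_sq_norm_le_of_mem_zeros hT (h.pos k) (h.step k) hw
    have hdisp := pow_le_pow_left₀ (norm_nonneg _) (h.norm_displaced_le w k) 2
    linarith
  simpa [Real.sqrt_sq (norm_nonneg _)] using hsq.sqrt

theorem tendsto_step (h : IsInexactPPA T L σ ε z a) (hT : IsMaximalMonotone T)
    (hε : Summable ε) {c : ℝ} (hc : 0 < c) (hσ : ∀ k, c ≤ σ k) (hw : w ∈ zeros T) :
    Tendsto (fun k => (σ k)⁻¹ • adjoint L (L (a k - z (k + 1)))) atTop (𝓝 0) := by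
  refine squeeze_zero_norm (a := fun k => c⁻¹ * (‖L‖ * ‖L (a k - z (k + 1))‖)) (fun k => ?_)
    (by simpa using ((h.tendsto_norm_step hT hε hw).const_mul ‖L‖).const_mul c⁻¹)
  rw [norm_smul, Real.norm_of_nonneg (inv_pos.2 (h.pos k)).le]
  exact mul_le_mul (inv_anti₀ hc (hσ k)) (norm_adjoint_apply_le L _) (norm_nonneg _)
    (inv_pos.2 hc).le

theorem isBounded_range [FiniteDimensional ℝ V] (h : IsInexactPPA T L σ ε z a)
    (hT : IsMaximalMonotone T) (hε : Summable ε) (hL : Function.Injective L)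
    (hne : (zeros T).Nonempty) : Bornology.IsBounded (Set.range z) := by
  obtain ⟨K, -, hK⟩ := L.toLinearMap.exists_antilipschitzWith (LinearMap.ker_eq_bot.2 hL)
  obtain ⟨w, hw⟩ := hne
  refine Metric.isBounded_closedBall.subset (t := Metric.closedBall w
    (K * (∑' j, ε j + ‖L (z 0 - w)‖))) (Set.range_subset_iff.2 fun k => ?_)
  refine (hK.le_mul_dist (z k) w).trans ?_
  rw [dist_eq_norm, ← map_sub]
  exact mul_le_mul_of_nonneg_left (h.norm_le_tsum_add hT hε hw k) K.2

theorem tendsto_of_subseq_tendsto [FiniteDimensional ℝ V] (h : IsInexactPPA T L σ ε z a)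
    (hT : IsMaximalMonotone T) (hε : Summable ε) (hL : Function.Injective L) (hw : w ∈ zeros T)
    {φ : ℕ → ℕ} (hφ : Tendsto φ atTop atTop) (hlim : Tendsto (z ∘ φ) atTop (𝓝 w)) :
    Tendsto z atTop (𝓝 w) := by
  obtain ⟨K, -, hK⟩ := L.toLinearMap.exists_antilipschitzWith (LinearMap.ker_eq_bot.2 hL)
  obtain ⟨l, hl⟩ := h.exists_tendsto_norm hT hε hw
  have hl₀ : l = 0 := tendsto_nhds_unique (hl.comp hφ) <| by
    simpa [Function.comp_def] using ((L.continuous.tendsto _).comp (hlim.sub_const w)).norm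
  rw [tendsto_iff_norm_sub_tendsto_zero]
  refine squeeze_zero (fun k => norm_nonneg _) (fun k => ?_)
    (by simpa [hl₀] using hl.const_mul (K : ℝ))
  simpa [dist_eq_norm] using hK.le_mul_dist (z k) w

theorem exists_tendsto [FiniteDimensional ℝ V] (h : IsInexactPPA T L σ ε z a)
    (hT : IsMaximalMonotone T) (hε : Summable ε) (hL : Function.Injective L) {c : ℝ} (hc : 0 < c)
    (hσ : ∀ k, c ≤ σ k) (hne : (zeros T).Nonempty) :
    ∃ w ∈ zeros T, Tendsto z atTop (𝓝 w) := by
  obtain ⟨x, -, φ, hφ, hx⟩ := tendsto_subseq_of_bounded (h.isBounded_range hT hε hL hne)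
    (x := fun k => z (k + 1)) fun k => Set.mem_range_self _
  obtain ⟨w, hw⟩ := hne
  have hx₀ : x ∈ zeros T := hT.mem_of_tendsto (fun k => h.step (φ k)) hx
    ((h.tendsto_step hT hε hc hσ hw).comp hφ.tendsto_atTop)
  exact ⟨x, hx₀, h.tendsto_of_subseq_tendsto hT hε hL hx₀ (φ := fun k => φ k + 1)
    ((tendsto_add_atTop_nat 1).comp hφ.tendsto_atTop) hx⟩

theorem infDist_succ_le_mu_mul (h : IsInexactPPA T L σ ε z a) (hT : IsMaximalMonotone T)
    (hε : Summable ε) (hne : (zeros T).Nonempty) {κ M : ℝ} (hκ : 0 < κ)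
    (hEB : HasErrorBound T κ (∑' j, ε j + Metric.infDist (L (z 0)) (L '' zeros T)))
    (hM : 1 ≤ M) (hL : ‖L‖ ≤ √M) {k : ℕ} {δ : ℝ} (hδ : δ ∈ Set.Ico 0 1)
    (hB : ‖L (a k - z k)‖ ≤ δ * ‖L (z (k + 1) - z k)‖) :
    Metric.infDist (L (z (k + 1))) (L '' zeros T)
      ≤ mu κ M (σ k) δ * Metric.infDist (L (z k)) (L '' zeros T) := by
  have hM₀ : 0 < M := one_pos.trans_le hM
  have hmu : 0 < mu κ M (σ k) δ := mu_pos hκ hM₀ hδ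
  rw [← div_le_iff₀' hmu, Metric.le_infDist (hne.image L)]
  rintro _ ⟨w, hw, rfl⟩
  rw [div_le_iff₀' hmu, dist_eq_norm, ← map_sub]
  have hstep := hEB.mul_infDist_image_le hT hκ.le hne hM hL (h.pos k) (h.step k)
    (h.infDist_le_tsum_add hT hε hne (k + 1))
  have hdist : Metric.infDist (L (z (k + 1))) (L '' zeros T) ≤ ‖L (z (k + 1) - w)‖ := by
    rw [map_sub, ← dist_eq_norm]
    exact Metric.infDist_le_dist_of_mem (Set.mem_image_of_mem L hw)
  have hsqrt := mul_sqrt_add_sq_le (h.pos k).le (by positivity) (norm_nonneg _)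
    Metric.infDist_nonneg hdist hstep
    (sq_norm_add_sq_norm_le_of_mem_zeros hT (h.pos k) (h.step k) hw)
  exact le_mu_mul_of_mul_sqrt_le hκ hM₀ hδ (norm_nonneg _) hsqrt
    (one_sub_mul_norm_le hδ.1 (norm_le_of_mem_zeros hT (h.pos k) (h.step k) hw) hB)

end IsInexactPPA

end ProximalPoint

/-! ### Saddle operators and the proximal augmented Lagrangian -/

section Diagonal

variable {E F E' F' : Type*} [NormedAddCommGroup E] [InnerProductSpace ℝ E]
  [NormedAddCommGroup F] [InnerProductSpace ℝ F] [NormedAddCommGroup E'] [InnerProductSpace ℝ E']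
  [NormedAddCommGroup F'] [InnerProductSpace ℝ F']

/-- The block diagonal operator `Diag(A, B)` between Euclidean product spaces. -/
def diag (A : E →L[ℝ] E') (B : F →L[ℝ] F') : WithLp 2 (E × F) →L[ℝ] WithLp 2 (E' × F') :=
  (WithLp.prodContinuousLinearEquiv 2 ℝ E' F').symm.toContinuousLinearMap ∘L
    A.prodMap B ∘L (WithLp.prodContinuousLinearEquiv 2 ℝ E F).toContinuousLinearMap

theorem diag_apply (A : E →L[ℝ] E') (B : F →L[ℝ] F') (x : WithLp 2 (E × F)) :
    diag A B x = WithLp.toLp 2 (A x.fst, B x.snd) := rfl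

theorem sq_norm_diag_apply (A : E →L[ℝ] E') (B : F →L[ℝ] F') (x : WithLp 2 (E × F)) :
    ‖diag A B x‖ ^ 2 = ‖A x.fst‖ ^ 2 + ‖B x.snd‖ ^ 2 :=
  WithLp.prod_norm_sq_eq_of_L2 _

theorem adjoint_diag [CompleteSpace E] [CompleteSpace F] [CompleteSpace E'] [CompleteSpace F']
    (A : E →L[ℝ] E') (B : F →L[ℝ] F') : adjoint (diag A B) = diag (adjoint A) (adjoint B) := by
  refine ((ContinuousLinearMap.eq_adjoint_iff _ _).2 fun x y => ?_).symm
  simp only [WithLp.prod_inner_apply, diag_apply, ContinuousLinearMap.adjoint_inner_left]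
  rfl

end Diagonal

section Saddle

variable {E F : Type*} [NormedAddCommGroup E] [InnerProductSpace ℝ E]
  [NormedAddCommGroup F] [InnerProductSpace ℝ F]

/-- The Lagrangian `f(x) - ⟨y, G x⟩ - δ_K*(-y)` of the problem of minimizing `f(x)` subject to
`G x ∈ K`. -/
def lagrangian (f : E → ℝ) (G : E →L[ℝ] F) (K : Set F) (x : E) (y : F) : EReal :=
  ((f x - inner ℝ y (G x) : ℝ) : EReal) - conj (ind K) (-y)

/-- The saddle operator of the Lagrangian: the pairs `(x', y')` of a convex subgradient `x'` in `x`
and a concave supergradient `-y'` in `y`. -/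
def saddleOp (f : E → ℝ) (G : E →L[ℝ] F) (K : Set F) (z : WithLp 2 (E × F)) :
    Set (WithLp 2 (E × F)) :=
  {w | (∀ x, lagrangian f G K z.fst z.snd + ((inner ℝ w.fst (x - z.fst) : ℝ) : EReal)
      ≤ lagrangian f G K x z.snd) ∧
    ∀ y, lagrangian f G K z.fst y
      ≤ lagrangian f G K z.fst z.snd + ((inner ℝ (-w.snd) (y - z.snd) : ℝ) : EReal)}

/-- The proximal augmented Lagrangian
`f(x) + σ E_{δ_K}(G x - y/σ) - ‖y‖²/(2σ) + ‖L (x - x₀)‖²/(2σ)`. -/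
def proxAugLagrangian {E' : Type*} [NormedAddCommGroup E'] [InnerProductSpace ℝ E'] (f : E → ℝ)
    (G : E →L[ℝ] F) (K : Set F) (L : E →L[ℝ] E') (σ : ℝ) (x₀ : E) (y : F) (x : E) : ℝ :=
  f x + σ * moreau (ind K) (G x - σ⁻¹ • y) - 1 / (2 * σ) * ‖y‖ ^ 2
    + 1 / (2 * σ) * ‖L (x - x₀)‖ ^ 2

/-- The multiplier update `-σ (G x - y/σ - Π_K(G x - y/σ))` of the augmented Lagrangian method. -/
def multiplierUpdate (G : E →L[ℝ] F) (K : Set F) (σ : ℝ) (y : F) (x : E) : F :=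
  -(σ • (G x - σ⁻¹ • y - prox (ind K) (G x - σ⁻¹ • y)))

section Multipliers

variable [CompleteSpace F] {f : E → ℝ} {G : E →L[ℝ] F} {K : Set F}

theorem coe_sub_le_coe_iff {a b : ℝ} {t : EReal} :
    (a : EReal) - t ≤ b ↔ ((a - b : ℝ) : EReal) ≤ t := by
  induction t using EReal.rec with
  | bot =>
    rw [EReal.coe_sub_bot]
    exact iff_of_false (EReal.coe_lt_top _).not_ge (EReal.bot_lt_coe _).not_ge
  | top => simp
  | coe t => norm_cast; exact sub_le_comm

theorem lagrangian_le_iff_mem_normalCone (hK : IsClosedConvex K) {c : ℝ} {x : E} {y q : F}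
    (hc : conj (ind K) (-y) = c) :
    (∀ y', lagrangian f G K x y' ≤ lagrangian f G K x y + ((inner ℝ (-q) (y' - y) : ℝ) : EReal)) ↔
      -y ∈ normalCone K (G x - q) := by
  rw [hK.mem_normalCone_iff_conj hc, (Equiv.neg F).forall_congr_left]
  refine forall_congr' fun y' => ?_
  rw [lagrangian, lagrangian, hc]
  norm_cast
  rw [coe_sub_le_coe_iff, Equiv.neg_symm, Equiv.neg_apply, neg_neg]
  have h : f x - inner ℝ (-y') (G x) - (f x - inner ℝ y (G x) - c + inner ℝ (-q) (-y' - y))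
      = c + inner ℝ (G x - q) (y' - -y) := by
    simp only [inner_neg_left, inner_sub_left, inner_sub_right, inner_neg_right,
      real_inner_comm (G x)]
    ring
  rw [h]

theorem neg_multiplierUpdate_mem_normalCone (hK : IsClosedConvex K) {σ : ℝ} (hσ : 0 < σ) (y : F)
    (x : E) : -multiplierUpdate G K σ y x
      ∈ normalCone K (G x - σ⁻¹ • (y - multiplierUpdate G K σ y x)) := by
  have hq : G x - σ⁻¹ • (y - multiplierUpdate G K σ y x) = prox (ind K) (G x - σ⁻¹ • y) := by
    rw [multiplierUpdate, sub_neg_eq_add, smul_add, inv_smul_smul₀ hσ.ne']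
    abel
  rw [hq, multiplierUpdate, neg_neg]
  exact smul_mem_normalCone hσ.le (hK.sub_prox_mem_normalCone _)

end Multipliers

variable [CompleteSpace E]

/-- A convex differentiable function `f` together with its gradient `f'`. -/
structure IsConvexGradient (f : E → ℝ) (f' : E → E) : Prop where
  hasGradientAt : ∀ x, HasGradientAt f (f' x) x
  add_inner_le : ∀ x x', f x + inner ℝ (f' x) (x' - x) ≤ f x'

theorem IsConvexGradient.inner_sub_nonneg {f : E → ℝ} {f' : E → E} (hf : IsConvexGradient f f')
    (x x' : E) : 0 ≤ inner ℝ (f' x - f' x') (x - x') := by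
  have h₁ := hf.add_inner_le x x'
  have h₂ := hf.add_inner_le x' x
  rw [← neg_sub, inner_neg_right] at h₁
  rw [inner_sub_left]
  linarith

theorem eq_of_hasGradientAt_of_add_inner_le {f : E → ℝ} {g g' x : E} (hf : HasGradientAt f g x)
    (h : ∀ x', f x + inner ℝ g' (x' - x) ≤ f x') : g' = g := by
  have hmin : IsLocalMin (fun x' => f x' - inner ℝ g' x') x := Eventually.of_forall fun x' => by
    have := h x'
    rw [inner_sub_right] at this
    linarith
  have hzero := hmin.hasFDerivAt_eq_zero (hf.hasFDerivAt.sub (innerSL ℝ g').hasFDerivAt)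
  refine (ext_inner_right ℝ fun v => sub_eq_zero.1 ?_).symm
  exact DFunLike.congr_fun hzero v

variable [CompleteSpace F] {f : E → ℝ} {f' : E → E} {G : E →L[ℝ] F} {K : Set F}
  {z z' w w' : WithLp 2 (E × F)}

theorem add_inner_le_lagrangian (hf : IsConvexGradient f f') {c : ℝ} {y : F}
    (hc : conj (ind K) (-y) = c) (x x' : E) :
    lagrangian f G K x y + ((inner ℝ (f' x - adjoint G y) (x' - x) : ℝ) : EReal)
      ≤ lagrangian f G K x' y := by
  rw [lagrangian, lagrangian, hc, inner_sub_left, ContinuousLinearMap.adjoint_inner_left, map_sub,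
    inner_sub_right y]
  norm_cast
  linarith [hf.add_inner_le x x']

theorem eq_of_forall_add_inner_le_lagrangian (hf : IsConvexGradient f f') {c : ℝ} {x g : E} {y : F}
    (hc : conj (ind K) (-y) = c)
    (h : ∀ x', lagrangian f G K x y + ((inner ℝ g (x' - x) : ℝ) : EReal)
      ≤ lagrangian f G K x' y) : g = f' x - adjoint G y := by
  rw [eq_sub_iff_add_eq]
  refine eq_of_hasGradientAt_of_add_inner_le (hf.hasGradientAt x) fun x' => ?_
  have := h x'
  rw [lagrangian, lagrangian, hc] at this
  norm_cast at this
  rw [inner_add_left, ContinuousLinearMap.adjoint_inner_left, map_sub, inner_sub_right y]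
  linarith

theorem mem_saddleOp_iff (hf : IsConvexGradient f f') (hK : IsClosedConvex K) :
    w ∈ saddleOp f G K z ↔ w.fst = f' z.fst - adjoint G z.snd
      ∧ -z.snd ∈ normalCone K (G z.fst - w.snd) := by
  constructor
  · rintro ⟨hx, hy⟩
    have hfin : conj (ind K) (-z.snd) ≠ ⊤ := fun htop => by
      have := hy 0
      simp [lagrangian, htop, conj_ind_zero hK.nonempty] at this
    have hc := (EReal.coe_toReal hfin (conj_ind_ne_bot hK.nonempty _)).symm
    exact ⟨eq_of_forall_add_inner_le_lagrangian hf hc hx,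
      (lagrangian_le_iff_mem_normalCone hK hc).1 hy⟩
  · rintro ⟨hx, hy⟩
    have hc := conj_ind_eq_of_mem_normalCone hy
    exact ⟨fun x => hx ▸ add_inner_le_lagrangian hf hc z.fst x,
      (lagrangian_le_iff_mem_normalCone hK hc).2 hy⟩

theorem inner_sub_sub_nonneg_of_mem_saddleOp (hf : IsConvexGradient f f') (hK : IsClosedConvex K)
    (h : w ∈ saddleOp f G K z) (h' : w' ∈ saddleOp f G K z') : 0 ≤ inner ℝ (w - w') (z - z') := by
  obtain ⟨hx, hy⟩ := (mem_saddleOp_iff hf hK).1 h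
  obtain ⟨hx', hy'⟩ := (mem_saddleOp_iff hf hK).1 h'
  have hmono := add_nonneg (hf.inner_sub_nonneg z.fst z'.fst) (normalCone_monotone hy hy')
  refine hmono.trans_eq ?_
  have e₁ : (w - w').fst = f' z.fst - f' z'.fst - adjoint G (z.snd - z'.snd) := by
    rw [WithLp.sub_fst, hx, hx', map_sub]
    abel
  have e₂ : G z.fst - w.snd - (G z'.fst - w'.snd) = G (z.fst - z'.fst) - (w.snd - w'.snd) := by
    rw [map_sub]
    abel
  have e₃ : -z.snd - -z'.snd = -(z.snd - z'.snd) := by abel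
  rw [WithLp.prod_inner_apply]
  change _ = inner ℝ (w - w').fst (z.fst - z'.fst) + inner ℝ (w.snd - w'.snd) (z.snd - z'.snd)
  rw [e₁, e₂, e₃, inner_sub_left _ (adjoint G _), ContinuousLinearMap.adjoint_inner_left,
    inner_neg_left, inner_sub_right (z.snd - z'.snd), real_inner_comm (w.snd - w'.snd)]
  ring

theorem forall_le_of_mem_zeros_saddleOp (hf : IsConvexGradient f f') (hK : IsClosedConvex K)
    (hz : z ∈ zeros (saddleOp f G K)) : G z.fst ∈ K ∧ ∀ x, G x ∈ K → f z.fst ≤ f x := by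
  rw [mem_zeros, mem_saddleOp_iff hf hK] at hz
  obtain ⟨hx, hy⟩ := hz
  rw [WithLp.zero_snd, sub_zero] at hy
  refine ⟨hy.1, fun x hxK => ?_⟩
  have hgrad : f' z.fst = adjoint G z.snd := (sub_eq_zero.1 hx.symm)
  have hle := hf.add_inner_le z.fst x
  have hnormal := hy.2 _ hxK
  rw [hgrad, ContinuousLinearMap.adjoint_inner_left, map_sub] at hle
  rw [inner_neg_left] at hnormal
  linarith

section ProximalStep

variable {E' : Type*} [NormedAddCommGroup E'] [InnerProductSpace ℝ E'] [CompleteSpace E']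

theorem hasGradientAt_proxAugLagrangian (hf : IsConvexGradient f f') (hK : IsClosedConvex K)
    (L : E →L[ℝ] E') (σ : ℝ) (x₀ : E) (y : F) (x : E) :
    HasGradientAt (proxAugLagrangian f G K L σ x₀ y)
      (f' x - adjoint G (multiplierUpdate G K σ y x) + σ⁻¹ • adjoint L (L (x - x₀))) x := by
  have hmoreau := ((hK.hasGradientAt_moreau_ind (G x - σ⁻¹ • y)).hasFDerivAt.comp x
    (G.hasFDerivAt.sub_const (σ⁻¹ • y))).const_mul σ
  have hprox := ((L.hasFDerivAt.comp x ((hasFDerivAt_id x).sub_const x₀)).norm_sq).const_mul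
    (1 / (2 * σ))
  rw [hasGradientAt_iff_hasFDerivAt]
  refine ((((hf.hasGradientAt x).hasFDerivAt.add hmoreau).sub_const _).add hprox).congr_fderiv ?_
  ext v
  simp only [map_sub, map_smul, ContinuousLinearMap.sub_comp, ContinuousLinearMap.smul_comp,
    one_div, mul_inv_rev, id_eq, Function.comp_apply, ContinuousLinearMap.comp_id, add_apply,
    InnerProductSpace.toDual_apply_apply, smul_apply, sub_apply, ContinuousLinearMap.comp_apply,
    smul_eq_mul, coe_innerSL_apply, nsmul_eq_mul, Nat.cast_ofNat, multiplierUpdate, map_neg,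
    sub_neg_eq_add, map_add, ContinuousLinearMap.adjoint_inner_left, add_right_inj]
  ring

theorem smul_adjoint_add_mem_saddleOp (hf : IsConvexGradient f f') (hK : IsClosedConvex K)
    (L : E →L[ℝ] E') {σ : ℝ} (hσ : 0 < σ) (h : z'.snd = multiplierUpdate G K σ z.snd z'.fst) :
    σ⁻¹ • adjoint (diag L (.id ℝ F)) (diag L (.id ℝ F) (z - z'))
      + WithLp.toLp 2 (gradient (proxAugLagrangian f G K L σ z.fst z.snd) z'.fst, 0)
      ∈ saddleOp f G K z' := by
  rw [mem_saddleOp_iff hf hK, adjoint_diag, diag_apply, diag_apply,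
    (hasGradientAt_proxAugLagrangian hf hK L σ z.fst z.snd z'.fst).gradient, ← h]
  constructor
  · change σ⁻¹ • adjoint L (L (z.fst - z'.fst))
      + (f' z'.fst - adjoint G z'.snd + σ⁻¹ • adjoint L (L (z'.fst - z.fst))) = _
    simp only [map_sub, smul_sub]
    abel
  · change -z'.snd ∈ normalCone K (G z'.fst - (σ⁻¹ • (adjoint (.id ℝ F) (z.snd - z'.snd)) + 0))
    rw [add_zero, ContinuousLinearMap.adjoint_id, h]
    exact neg_multiplierUpdate_mem_normalCone hK hσ _ _

end ProximalStep

theorem exists_forall_proxAugLagrangian_le [FiniteDimensional ℝ E] (hf : IsConvexGradient f f')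
    (hK : IsClosedConvex K) {σ : ℝ} (hσ : 0 < σ) (x₀ : E) (y : F) :
    ∃ x, ∀ x', proxAugLagrangian f G K (.id ℝ E) σ x₀ y x
      ≤ proxAugLagrangian f G K (.id ℝ E) σ x₀ y x' := by
  have hcont : Continuous (proxAugLagrangian f G K (.id ℝ E) σ x₀ y) :=
    continuous_iff_continuousAt.2 fun x =>
      (hasGradientAt_proxAugLagrangian hf hK _ σ x₀ y x).continuousAt
  have hlow : ∀ x, ‖x - x₀‖ * (1 / (2 * σ) * ‖x - x₀‖ - ‖f' x₀‖)
      + (f x₀ - 1 / (2 * σ) * ‖y‖ ^ 2) ≤ proxAugLagrangian f G K (.id ℝ E) σ x₀ y x := fun x => by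
    have hmoreau : 0 ≤ σ * moreau (ind K) (G x - σ⁻¹ • y) := by
      rw [hK.moreau_ind_eq]
      positivity
    have hinner := neg_le_of_abs_le (abs_real_inner_le_norm (f' x₀) (x - x₀))
    rw [proxAugLagrangian, ContinuousLinearMap.id_apply]
    linarith [hf.add_inner_le x₀ x]
  have hnorm : Tendsto (fun x => ‖x - x₀‖) (cocompact E) atTop := by
    simpa only [dist_eq_norm] using tendsto_dist_right_cocompact_atTop x₀
  exact hcont.exists_forall_le (tendsto_atTop_mono hlow (tendsto_atTop_add_const_right _ _
    (hnorm.atTop_mul_atTop₀ (tendsto_atTop_add_const_right _ _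
      (hnorm.const_mul_atTop (by positivity))))))

theorem isMaximalMonotone_saddleOp [FiniteDimensional ℝ E] (hf : IsConvexGradient f f')
    (hK : IsClosedConvex K) : IsMaximalMonotone (saddleOp f G K) where
  inner_nonneg _ _ _ _ := inner_sub_sub_nonneg_of_mem_saddleOp hf hK
  surjective η hη y := by
    obtain ⟨z, rfl⟩ : ∃ z, y = η • z := ⟨η⁻¹ • y, (smul_inv_smul₀ hη.ne' y).symm⟩
    obtain ⟨x, hx⟩ := exists_forall_proxAugLagrangian_le (G := G) hf hK (inv_pos.2 hη) z.fst z.snd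
    obtain ⟨z', rfl, hz'⟩ : ∃ z' : WithLp 2 (E × F),
        z'.fst = x ∧ z'.snd = multiplierUpdate G K η⁻¹ z.snd z'.fst :=
      ⟨WithLp.toLp 2 (x, multiplierUpdate G K η⁻¹ z.snd x), rfl, rfl⟩
    have hgrad : gradient (proxAugLagrangian f G K (.id ℝ E) η⁻¹ z.fst z.snd) z'.fst = 0 := by
      rw [gradient, IsLocalMin.fderiv_eq_zero (Eventually.of_forall hx), map_zero]
    have hstep := smul_adjoint_add_mem_saddleOp hf hK (.id ℝ E) (inv_pos.2 hη) hz'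
    rw [hgrad, adjoint_diag, ContinuousLinearMap.adjoint_id, ContinuousLinearMap.adjoint_id,
      inv_inv] at hstep
    refine ⟨z', ?_⟩
    rw [← smul_sub]
    convert hstep using 1
    exact (add_zero _).symm

end Saddle

/-! ### The weighted norm -/

section Weights

open scoped MatrixOrder

variable {ι : Type*} [Fintype ι] [DecidableEq ι] {H H' : Matrix ι ι ℝ}

theorem inner_act_le_inner_act (h : H ≤ H') (x : EuclideanSpace ℝ ι) :
    inner ℝ x (act H x) ≤ inner ℝ x (act H' x) := by
  have hpos := (Matrix.isPositive_toEuclideanLin_iff.2 (Matrix.le_iff.1 h)).re_inner_nonneg_right x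
  rwa [map_sub, LinearMap.sub_apply, inner_sub_right, RCLike.re_to_real, sub_nonneg] at hpos

theorem inner_act_algebraMap (c : ℝ) (x : EuclideanSpace ℝ ι) :
    inner ℝ x (act (algebraMap ℝ _ c) x) = c * ‖x‖ ^ 2 := by
  rw [act, Algebra.algebraMap_eq_smul_one, map_smul, LinearMap.smul_apply, Matrix.toLpLin_one,
    LinearMap.id_apply, real_inner_smul_right, real_inner_self_eq_norm_sq]

theorem eigMin_mul_sq_norm_le (hH : H.IsHermitian) (x : EuclideanSpace ℝ ι) :
    eigMin H * ‖x‖ ^ 2 ≤ inner ℝ x (act H x) := by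
  rw [← inner_act_algebraMap]
  exact inner_act_le_inner_act ((algebraMap_le_iff_le_spectrum hH).2 fun _ hc =>
    csInf_le Matrix.finite_real_spectrum.bddBelow hc) x

theorem inner_act_le_eigMax_mul_sq_norm (hH : H.IsHermitian) (x : EuclideanSpace ℝ ι) :
    inner ℝ x (act H x) ≤ eigMax H * ‖x‖ ^ 2 := by
  rw [← inner_act_algebraMap]
  exact inner_act_le_inner_act ((le_algebraMap_iff_spectrum_le hH).2 fun _ hc =>
    le_csSup Matrix.finite_real_spectrum.bddAbove hc) x

/-- The square root of a positive semidefinite matrix as an operator on Euclidean space; it turns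
`‖·‖_H` into the Euclidean norm. -/
def sqrtOp (H : Matrix ι ι ℝ) : EuclideanSpace ℝ ι →L[ℝ] EuclideanSpace ℝ ι :=
  Matrix.toEuclideanCLM (𝕜 := ℝ) (CFC.sqrt H)

theorem sq_norm_sqrtOp_apply (hH : H.PosSemidef) (x : EuclideanSpace ℝ ι) :
    ‖sqrtOp H x‖ ^ 2 = inner ℝ x (act H x) := by
  have hsqrt : act H x = adjoint (sqrtOp H) (sqrtOp H x) := by
    rw [← ContinuousLinearMap.star_eq_adjoint, sqrtOp, ← map_star,
      (CFC.sqrt_nonneg H).isSelfAdjoint.star_eq, ← mul_apply_eq_comp, ← map_mul,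
      CFC.sqrt_mul_sqrt_self H hH.nonneg]
    rfl
  rw [hsqrt, ContinuousLinearMap.adjoint_inner_right, real_inner_self_eq_norm_sq]

theorem wnorm_eq (hH : H.PosSemidef) (x : EuclideanSpace ℝ ι) : wnorm H x = ‖sqrtOp H x‖ := by
  rw [wnorm, ← sq_norm_sqrtOp_apply hH, Real.sqrt_sq (norm_nonneg _)]

theorem sqrtOp_injective (hH : H.PosDef) : Function.Injective (sqrtOp H) :=
  (ContinuousLinearMap.isUnit_iff_bijective.1
    (((CFC.isUnit_sqrt_iff H hH.posSemidef.nonneg).2 hH.isUnit).map _)).1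

end Weights

section Sigma

variable {n d : ℕ} {H₁ : Matrix (Fin n) (Fin n) ℝ} {H₂ : Matrix (Fin n × Fin d) (Fin n × Fin d) ℝ}

/-- The square root of `Σ = Diag(H₁, H₂, I, I)`, which turns `‖·‖_Σ` into the Euclidean norm. -/
def sigmaSqrt (H₁ : Matrix (Fin n) (Fin n) ℝ) (H₂ : Matrix (Fin n × Fin d) (Fin n × Fin d) ℝ) :
    PD n d →L[ℝ] PD n d :=
  diag (diag (sqrtOp H₁) (sqrtOp H₂)) (.id ℝ (Dual n d))

theorem sq_norm_sigmaSqrt_apply (z : PD n d) : ‖sigmaSqrt H₁ H₂ z‖ ^ 2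
    = ‖sqrtOp H₁ z.fst.fst‖ ^ 2 + ‖sqrtOp H₂ z.fst.snd‖ ^ 2 + ‖z.snd‖ ^ 2 := by
  rw [sigmaSqrt, sq_norm_diag_apply, sq_norm_diag_apply, ContinuousLinearMap.id_apply]

theorem normSig_eq (hH₁ : H₁.PosSemidef) (hH₂ : H₂.PosSemidef) (z : PD n d) :
    normSig H₁ H₂ z = ‖sigmaSqrt H₁ H₂ z‖ := by
  rw [normSig, ← sq_norm_sqrtOp_apply hH₁, ← sq_norm_sqrtOp_apply hH₂, add_assoc,
    ← WithLp.prod_norm_sq_eq_of_L2, ← sq_norm_sigmaSqrt_apply, Real.sqrt_sq (norm_nonneg _)]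

theorem distSig_eq (hH₁ : H₁.PosSemidef) (hH₂ : H₂.PosSemidef) (z : PD n d) (C : Set (PD n d)) :
    distSig H₁ H₂ z C = Metric.infDist (sigmaSqrt H₁ H₂ z) (sigmaSqrt H₁ H₂ '' C) := by
  simp only [distSig, normSig_eq hH₁ hH₂, map_sub, ← dist_eq_norm]
  rw [Metric.infDist_eq_iInf, ← sInf_image', Set.image_image, sInf_image']

theorem sigmaSqrt_injective (hH₁ : H₁.PosDef) (hH₂ : H₂.PosDef) :
    Function.Injective (sigmaSqrt H₁ H₂) := fun z z' h => by
  have h₁ : sqrtOp H₁ z.fst.fst = sqrtOp H₁ z'.fst.fst := congrArg (fun w : PD n d => w.fst.fst) h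
  have h₂ : sqrtOp H₂ z.fst.snd = sqrtOp H₂ z'.fst.snd := congrArg (fun w : PD n d => w.fst.snd) h
  have h₃ : z.snd = z'.snd :=
    (congrArg (fun w : PD n d => w.snd) h : (sigmaSqrt H₁ H₂ z).snd = (sigmaSqrt H₁ H₂ z').snd)
  exact WithLp.ofLp_injective 2 (Prod.ext (WithLp.ofLp_injective 2
    (Prod.ext (sqrtOp_injective hH₁ h₁) (sqrtOp_injective hH₂ h₂))) h₃)

theorem sq_norm_eq (z : PD n d) :
    ‖z‖ ^ 2 = ‖z.fst.fst‖ ^ 2 + ‖z.fst.snd‖ ^ 2 + ‖z.snd‖ ^ 2 := by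
  rw [WithLp.prod_norm_sq_eq_of_L2, WithLp.prod_norm_sq_eq_of_L2 z.fst]

theorem eigMin_nonneg {ι : Type*} [Fintype ι] [DecidableEq ι] {H : Matrix ι ι ℝ}
    (hH : H.PosSemidef) : 0 ≤ eigMin H :=
  Real.sInf_nonneg (Matrix.posSemidef_iff_isHermitian_and_spectrum_nonneg.1 hH).2

theorem one_le_lamMax : 1 ≤ lamMax H₁ H₂ := le_max_of_le_right (le_max_right _ _)

theorem norm_sigmaSqrt_le (hH₁ : H₁.PosSemidef) (hH₂ : H₂.PosSemidef) :
    ‖sigmaSqrt H₁ H₂‖ ≤ √(lamMax H₁ H₂) := by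
  refine ContinuousLinearMap.opNorm_le_bound _ (Real.sqrt_nonneg _) fun z => ?_
  refine le_of_sq_le_sq ?_ (by positivity)
  rw [mul_pow, Real.sq_sqrt (zero_le_one.trans one_le_lamMax), sq_norm_sigmaSqrt_apply, sq_norm_eq,
    mul_add, mul_add, sq_norm_sqrtOp_apply hH₁, sq_norm_sqrtOp_apply hH₂]
  gcongr
  · exact (inner_act_le_eigMax_mul_sq_norm hH₁.1 _).trans (by gcongr; exact le_max_left _ _)
  · exact (inner_act_le_eigMax_mul_sq_norm hH₂.1 _).trans
      (by gcongr; exact le_max_of_le_right (le_max_left _ _))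
  · exact le_mul_of_one_le_left (sq_nonneg _) one_le_lamMax

theorem sqrt_lamMin_mul_norm_le (hH₁ : H₁.PosSemidef) (hH₂ : H₂.PosSemidef) (z : PD n d) :
    √(lamMin H₁ H₂) * ‖z‖ ≤ ‖sigmaSqrt H₁ H₂ z‖ := by
  refine le_of_sq_le_sq ?_ (norm_nonneg _)
  have hnonneg : 0 ≤ lamMin H₁ H₂ :=
    le_min (eigMin_nonneg hH₁) (le_min (eigMin_nonneg hH₂) zero_le_one)
  rw [mul_pow, Real.sq_sqrt hnonneg, sq_norm_sigmaSqrt_apply, sq_norm_eq,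
    mul_add, mul_add, sq_norm_sqrtOp_apply hH₁, sq_norm_sqrtOp_apply hH₂]
  gcongr
  · exact (mul_le_mul_of_nonneg_right (min_le_left _ _) (sq_nonneg _)).trans
      (eigMin_mul_sq_norm_le hH₁.1 _)
  · exact (mul_le_mul_of_nonneg_right (min_le_of_right_le (min_le_left _ _)) (sq_nonneg _)).trans
      (eigMin_mul_sq_norm_le hH₂.1 _)
  · exact mul_le_of_le_one_left (sq_nonneg _) (min_le_of_right_le (min_le_right _ _))

end Sigma

/-! ### Shape-constrained regression -/

section Orthant

variable {n : ℕ}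

theorem isClosedConvex_orthant : IsClosedConvex (orthant n) where
  nonempty := ⟨0, fun _ => le_rfl⟩
  isClosed := by
    rw [orthant, Set.ofPred_forall]
    exact isClosed_iInter fun i => isClosed_le continuous_const (by fun_prop)
  convex := fun _ hx _ hy _ _ ha hb _ i =>
    add_nonneg (mul_nonneg ha (hx i)) (mul_nonneg hb (hy i))

theorem neg_mem_normalCone_orthant_zero {u : USp n} (hu : u ∈ orthant n) :
    -u ∈ normalCone (orthant n) 0 :=
  ⟨fun _ => le_rfl, fun q hq => by
    rw [sub_zero, inner_neg_left, neg_nonpos, PiLp.inner_apply]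
    exact Finset.sum_nonneg fun i _ => mul_nonneg (hq i) (hu i)⟩

theorem conj_ind_orthant_eq_top {u : USp n} (hu : u ∉ orthant n) :
    conj (ind (orthant n)) (-u) = ⊤ := by
  obtain ⟨i, hi⟩ := not_forall.1 hu
  rw [not_le, ← neg_pos] at hi
  refine EReal.eq_top_iff_forall_lt _ |>.2 fun y => ?_
  have hq : EuclideanSpace.single i ((|y| + 1) / -u i) ∈ orthant n := fun j => by
    rw [PiLp.single_apply]
    split_ifs
    exacts [by positivity, le_rfl]
  refine lt_of_lt_of_le ?_ (inner_le_conj_ind hq (-u))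
  rw [EuclideanSpace.inner_single_left, conj_trivial, PiLp.neg_apply, div_mul_cancel₀ _ hi.ne']
  exact_mod_cast (le_abs_self y).trans_lt (lt_add_one _)

theorem conj_ind_orthant (u : USp n) : conj (ind (orthant n)) (-u) = ind (orthant n) u := by
  by_cases hu : u ∈ orthant n
  · rw [ind_of_mem hu, conj_ind_eq_of_mem_normalCone (neg_mem_normalCone_orthant_zero hu),
      inner_zero_left, EReal.coe_zero]
  · rw [ind_of_notMem hu, conj_ind_orthant_eq_top hu]

end Orthant

section Regression

variable {n d : ℕ}

theorem inner_act_transpose {ι κ : Type*} [Fintype ι] [DecidableEq ι] [Fintype κ] [DecidableEq κ]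
    (M : Matrix ι κ ℝ) (x : EuclideanSpace ℝ κ) (y : EuclideanSpace ℝ ι) :
    inner ℝ x (act M.transpose y) = inner ℝ (act M x) y := by
  rw [act, ← Matrix.conjTranspose_eq_transpose_of_trivial,
    Matrix.toEuclideanLin_conjTranspose_eq_adjoint, LinearMap.adjoint_inner_right]

namespace Data

variable (P : Data n d)

/-- The domain `D × ⋯ × D` of `p`. -/
def xiSet : Set (XiSp n d) := {ξ | ∀ i, block ξ i ∈ P.D}

/-- The set `K = ℝ₊^{n²} × (D × ⋯ × D)`; (P) is the minimization of `P.loss x` subject to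
`P.constraintMap x ∈ K`. -/
def feasibleSet : Set (Dual n d) := prodSet (orthant n) P.xiSet

/-- The linear map `(θ, ξ) ↦ (Aθ + Bξ, ξ)`. -/
def constraintMap : Primal n d →L[ℝ] Dual n d :=
  (WithLp.prodContinuousLinearEquiv 2 ℝ (USp n) (XiSp n d)).symm.toContinuousLinearMap ∘L
    ((Matrix.toEuclideanLin (matA n)).toContinuousLinearMap.coprod
      (Matrix.toEuclideanLin P.matB).toContinuousLinearMap).prod (.snd ℝ (ThetaSp n) (XiSp n d)) ∘L
    (WithLp.prodContinuousLinearEquiv 2 ℝ (ThetaSp n) (XiSp n d)).toContinuousLinearMap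

/-- The smooth part `½‖θ - Y‖²` of the objective of (P). -/
def loss (x : Primal n d) : ℝ := 1 / 2 * ‖x.fst - P.Y‖ ^ 2

theorem constraintMap_apply (x : Primal n d) :
    P.constraintMap x = WithLp.toLp 2 (P.cons x, x.snd) := rfl

theorem adjoint_constraintMap_apply (y : Dual n d) : adjoint P.constraintMap y
    = WithLp.toLp 2 (act (matA n).transpose y.fst, act P.matB.transpose y.fst + y.snd) := by
  refine ext_inner_left ℝ fun x => ?_
  rw [ContinuousLinearMap.adjoint_inner_right, constraintMap_apply, WithLp.prod_inner_apply,
    WithLp.prod_inner_apply]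
  change inner ℝ (P.cons x) y.fst + inner ℝ x.snd y.snd
    = inner ℝ x.fst (act (matA n).transpose y.fst)
      + inner ℝ x.snd (act P.matB.transpose y.fst + y.snd)
  rw [cons, inner_add_left, inner_add_right, inner_act_transpose, inner_act_transpose, add_assoc]

theorem isConvexGradient_loss :
    IsConvexGradient P.loss fun x => WithLp.toLp 2 (x.fst - P.Y, 0) := by
  have hexpand : ∀ x x' : Primal n d, P.loss x'
      = P.loss x + inner ℝ (WithLp.toLp 2 (x.fst - P.Y, 0) : Primal n d) (x' - x)
        + 1 / 2 * ‖(x' - x).fst‖ ^ 2 := fun x x' => by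
    have hsplit : x'.fst - P.Y = x.fst - P.Y + (x' - x).fst := by
      rw [WithLp.sub_fst]
      abel
    rw [loss, loss, hsplit, norm_add_sq_real, WithLp.prod_inner_apply]
    change _ = _ + (inner ℝ (x.fst - P.Y) (x' - x).fst + inner ℝ 0 (x' - x).snd) + _
    rw [inner_zero_left]
    ring
  refine ⟨fun x => hasGradientAt_of_abs_sub_le (c := 1 / 2) fun x' => ?_, fun x x' => ?_⟩
  · rw [hexpand x x', add_assoc, add_sub_cancel_left, add_sub_cancel_left,
      abs_of_nonneg (by positivity), WithLp.prod_norm_sq_eq_of_L2 (x' - x)]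
    gcongr
    exact le_add_of_nonneg_right (sq_nonneg _)
  · rw [hexpand x x']
    exact le_add_of_nonneg_right (by positivity)

theorem p_eq_ind : P.p = ind P.xiSet := by
  funext ξ
  by_cases h : ξ ∈ P.xiSet
  · rw [ind_of_mem h, p]
    exact Finset.sum_eq_zero fun i _ => ind_of_mem (h i)
  · obtain ⟨i, hi⟩ := not_forall.1 h
    rw [ind_of_notMem h, p, ← Finset.add_sum_erase _ _ (Finset.mem_univ i), ind_of_notMem hi]
    refine EReal.top_add_of_ne_bot (ne_bot_of_le_ne_bot EReal.zero_ne_bot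
      (Finset.sum_nonneg fun j _ => ?_))
    rw [ind]
    split_ifs
    exacts [le_rfl, le_top]

variable {P}

theorem isClosedConvex_xiSet (hD : IsClosedConvex P.D) : IsClosedConvex P.xiSet where
  nonempty := ⟨WithLp.toLp 2 fun r => hD.nonempty.some r.2, fun _ => hD.nonempty.some_mem⟩
  isClosed := by
    rw [xiSet, Set.ofPred_forall]
    refine isClosed_iInter fun i => hD.isClosed.preimage ?_
    unfold block
    fun_prop
  convex := fun _ hx _ hy _ _ ha hb hab i => hD.convex (hx i) (hy i) ha hb hab

theorem isClosedConvex_feasibleSet (hD : IsClosedConvex P.D) : IsClosedConvex P.feasibleSet :=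
  isClosedConvex_orthant.prodSet (isClosedConvex_xiSet hD)

theorem lagr_eq_lagrangian (hD : IsClosedConvex P.D) :
    P.lagr = lagrangian P.loss P.constraintMap P.feasibleSet := by
  funext x y
  have hp : conj (ind P.xiSet) (-y.snd) ≠ ⊥ :=
    conj_ind_ne_bot (isClosedConvex_xiSet hD).nonempty _
  have ho : conj (ind (orthant n)) (-y.fst) ≠ ⊥ :=
    conj_ind_ne_bot isClosedConvex_orthant.nonempty _
  have hinner : inner ℝ y (P.constraintMap x)
      = inner ℝ y.snd x.snd + inner ℝ y.fst (P.cons x) := by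
    rw [constraintMap_apply, WithLp.prod_inner_apply, add_comm]
    rfl
  rw [lagr, lagrangian, feasibleSet, conj_ind_prodSet, WithLp.neg_fst, WithLp.neg_snd, p_eq_ind,
    ← conj_ind_orthant, loss, hinner, sub_add_eq_sub_sub, add_comm (conj _ _),
    sub_eq_add_neg _ (_ + _), EReal.neg_add (.inl hp) (.inr ho)]
  simp only [sub_eq_add_neg, add_assoc]

theorem Tl_eq_saddleOp (hD : IsClosedConvex P.D) :
    P.Tl = saddleOp P.loss P.constraintMap P.feasibleSet := by
  funext z
  rw [Tl, saddleOp, lagr_eq_lagrangian hD]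

theorem isMaximalMonotone_Tl (hD : IsClosedConvex P.D) : IsMaximalMonotone P.Tl :=
  Tl_eq_saddleOp hD ▸
    isMaximalMonotone_saddleOp P.isConvexGradient_loss (isClosedConvex_feasibleSet hD)

theorem kktSet_eq_Lam (hD : IsClosedConvex P.D) : P.kktSet = P.Lam := by
  ext z
  change _ ↔ z ∈ zeros P.Tl
  rw [mem_zeros, Tl_eq_saddleOp hD,
    mem_saddleOp_iff P.isConvexGradient_loss (isClosedConvex_feasibleSet hD),
    adjoint_constraintMap_apply, feasibleSet, mem_normalCone_prodSet_iff, WithLp.zero_snd, sub_zero]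
  have hgrad : ∀ {a b : ThetaSp n} {c : XiSp n d},
      (0 : Primal n d) = WithLp.toLp 2 (a, 0) - WithLp.toLp 2 (b, c) ↔ a - b = 0 ∧ c = 0 :=
    fun {a b c} => by
      rw [← WithLp.toLp_sub, Prod.mk_sub_mk, zero_sub, eq_comm, WithLp.toLp_eq_zero,
        Prod.mk_eq_zero, neg_eq_zero]
  change _ ∧ _ ∧ _ ∈ subdiff P.p _ ∧ _ ∈ subdiff _ _ ↔ (0 : Primal n d) = _ ∧ _
  rw [hgrad, p_eq_ind, subdiff_ind (isClosedConvex_xiSet hD).nonempty,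
    subdiff_ind isClosedConvex_orthant.nonempty, and_assoc,
    and_comm (a := _ ∈ normalCone P.xiSet _)]
  rfl

theorem primalObj_eq (x : Primal n d) :
    P.primalObj x = (P.loss x : EReal) + ind P.feasibleSet (P.constraintMap x) := by
  rw [primalObj, p_eq_ind, add_assoc, add_comm (ind P.xiSet _), loss, feasibleSet, ind_prodSet]
  rfl

theorem isPrimalOptimal_of_mem_Lam (hD : IsClosedConvex P.D) {z : PD n d} (hz : z ∈ P.Lam) :
    P.IsPrimalOptimal z.fst := by
  have hzero : z ∈ zeros (saddleOp P.loss P.constraintMap P.feasibleSet) :=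
    Tl_eq_saddleOp hD ▸ hz
  obtain ⟨hmem, hmin⟩ := forall_le_of_mem_zeros_saddleOp P.isConvexGradient_loss
    (isClosedConvex_feasibleSet hD) hzero
  have hval : P.primalObj z.fst = P.loss z.fst := by
    rw [primalObj_eq, ind_of_mem hmem, add_zero]
  refine ⟨hval ▸ EReal.coe_ne_top _, fun x => ?_⟩
  by_cases hx : P.constraintMap x ∈ P.feasibleSet
  · rw [hval, primalObj_eq, ind_of_mem hx, add_zero]
    exact_mod_cast hmin x hx
  · rw [primalObj_eq x, ind_of_notMem hx, EReal.coe_add_top]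
    exact le_top

theorem lagr_eq_dualObj_add {y : Dual n d} (hy : P.DualConstraint y) (x : Primal n d) :
    P.lagr x y = P.dualObj y
      + ((1 / 2 * ‖x.fst - P.Y - act (matA n).transpose y.fst‖ ^ 2 : ℝ) : EReal) := by
  have hinner : inner ℝ y.snd x.snd + inner ℝ y.fst (P.cons x)
      = inner ℝ x.fst (act (matA n).transpose y.fst) := by
    rw [eq_neg_of_add_eq_zero_right hy, cons, inner_add_right, inner_neg_left,
      real_inner_comm x.snd, inner_act_transpose, inner_act_transpose, real_inner_comm y.fst,
      real_inner_comm y.fst]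
    ring
  have hsq : 1 / 2 * ‖x.fst - P.Y‖ ^ 2 - inner ℝ y.snd x.snd - inner ℝ y.fst (P.cons x)
      = -(1 / 2) * ‖act (matA n).transpose y.fst‖ ^ 2
          - inner ℝ P.Y (act (matA n).transpose y.fst)
        + 1 / 2 * ‖x.fst - P.Y - act (matA n).transpose y.fst‖ ^ 2 := by
    rw [norm_sub_sq_real (_ - _), inner_sub_left, sub_sub, hinner]
    ring
  rw [lagr, dualObj, hsq, EReal.coe_add]
  simp only [sub_eq_add_neg]
  rw [add_right_comm _ _ (-conj _ _), add_right_comm _ _ (-ind _ _)]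

theorem isDualOptimal_of_mem_Lam (hD : IsClosedConvex P.D) {z : PD n d} (hz : z ∈ P.Lam) :
    P.IsDualOptimal z.snd := by
  obtain ⟨hgrad, hdual, -, -⟩ : z ∈ P.kktSet := (kktSet_eq_Lam hD).symm ▸ hz
  have hval : P.lagr z.fst z.snd = P.dualObj z.snd := by
    rw [lagr_eq_dualObj_add hdual, hgrad]
    simp
  have hsaddle : ∀ y, P.lagr z.fst y ≤ P.dualObj z.snd := fun y => by
    simpa [hval] using (show (0 : PD n d) ∈ P.Tl z from hz).2 y
  refine ⟨hdual, ne_bot_of_le_ne_bot ?_ (hsaddle 0), fun y hy => ?_⟩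
  · rw [lagr_eq_lagrangian hD, lagrangian, neg_zero,
      conj_ind_zero (isClosedConvex_feasibleSet hD).nonempty, sub_zero]
    exact EReal.coe_ne_bot _
  · calc P.dualObj y ≤ P.lagr z.fst y := by
          rw [lagr_eq_dualObj_add hy]
          exact le_add_of_nonneg_right (by exact_mod_cast by positivity)
      _ ≤ P.dualObj z.snd := hsaddle y

end Data

end Regression

/-! ### The iterates -/

section Iterates

variable {n d : ℕ} {P : Data n d}
  {H₁ : Matrix (Fin n) (Fin n) ℝ} {H₂ : Matrix (Fin n × Fin d) (Fin n × Fin d) ℝ}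
  {σ ε : ℕ → ℝ} {z : ℕ → PD n d}

theorem Phi_eq (hD : IsClosedConvex P.D) (hH₁ : H₁.PosSemidef) (hH₂ : H₂.PosSemidef) (σ : ℝ)
    (z : PD n d) : Phi P H₁ H₂ σ z = proxAugLagrangian P.loss P.constraintMap P.feasibleSet
      (diag (sqrtOp H₁) (sqrtOp H₂)) σ z.fst z.snd := by
  funext x
  rw [Phi, Data.augLagr, proxAugLagrangian, Data.feasibleSet,
    isClosedConvex_orthant.moreau_ind_prodSet (Data.isClosedConvex_xiSet hD), ← P.p_eq_ind,
    sq_norm_diag_apply, wnorm_eq hH₁, wnorm_eq hH₂, WithLp.prod_norm_sq_eq_of_L2 z.snd]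
  change _ = P.loss x + σ * (moreau _ (P.cons x - σ⁻¹ • z.snd.fst)
    + moreau P.p (x.snd - σ⁻¹ • z.snd.snd)) - _ + 1 / (2 * σ) *
      (‖sqrtOp H₁ (x.fst - z.fst.fst)‖ ^ 2 + ‖sqrtOp H₂ (x.snd - z.fst.snd)‖ ^ 2)
  rw [Data.loss]
  ring

namespace IsIterates

theorem snd_succ_eq_multiplierUpdate (hz : IsIterates P H₁ H₂ σ ε z) (hD : IsClosedConvex P.D)
    (k : ℕ) : (z (k + 1)).snd
      = multiplierUpdate P.constraintMap P.feasibleSet (σ k) (z k).snd (z (k + 1)).fst := by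
  rw [multiplierUpdate, Data.feasibleSet,
    isClosedConvex_orthant.prox_ind_prodSet (Data.isClosedConvex_xiSet hD), ← P.p_eq_ind]
  exact WithLp.ofLp_injective 2 (Prod.ext (hz.update_u k) (hz.update_v k))

theorem exists_displacement (hz : IsIterates P H₁ H₂ σ ε z) (hD : IsClosedConvex P.D)
    (hH₁ : H₁.PosDef) (hH₂ : H₂.PosDef) {k : ℕ} (hσ : 0 < σ k) :
    ∃ a : PD n d, (σ k)⁻¹ • adjoint (sigmaSqrt H₁ H₂) (sigmaSqrt H₁ H₂ (a - z (k + 1)))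
        ∈ P.Tl (z (k + 1)) ∧
      ∀ t, 0 ≤ t → ‖gradient (Phi P H₁ H₂ (σ k) (z k)) (z (k + 1)).fst‖
        ≤ √(lamMin H₁ H₂) / σ k * t → ‖sigmaSqrt H₁ H₂ (a - z k)‖ ≤ t := by
  obtain ⟨b, hb⟩ := exists_adjoint_apply_eq (sigmaSqrt_injective hH₁ hH₂)
    (σ k • (WithLp.toLp 2 (gradient (Phi P H₁ H₂ (σ k) (z k)) (z (k + 1)).fst, 0) : PD n d))
  refine ⟨z k + b, ?_, fun t ht hgrad => ?_⟩
  · rw [add_sub_right_comm, map_add, map_add, hb, smul_add, inv_smul_smul₀ hσ.ne',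
      Data.Tl_eq_saddleOp hD, Phi_eq hD hH₁.posSemidef hH₂.posSemidef]
    exact smul_adjoint_add_mem_saddleOp P.isConvexGradient_loss
      (Data.isClosedConvex_feasibleSet hD) _ hσ (hz.snd_succ_eq_multiplierUpdate hD k)
  · rw [add_sub_cancel_left]
    refine norm_le_of_norm_adjoint_apply_le (Real.sqrt_nonneg _)
      (sqrt_lamMin_mul_norm_le hH₁.posSemidef hH₂.posSemidef) ht ?_
    rw [hb, norm_smul, Real.norm_of_nonneg hσ.le, WithLp.norm_toLp_fst, ← le_div_iff₀' hσ,
      mul_div_right_comm]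
    exact hgrad

theorem exists_isInexactPPA (hz : IsIterates P H₁ H₂ σ ε z) (hD : IsClosedConvex P.D)
    (hH₁ : H₁.PosDef) (hH₂ : H₂.PosDef) (hσ : ∀ k, 0 < σ k) (hε : ∀ k, 0 ≤ ε k) :
    ∃ a, IsInexactPPA P.Tl (sigmaSqrt H₁ H₂) σ ε z a ∧
      ∀ k t, 0 ≤ t → ‖gradient (Phi P H₁ H₂ (σ k) (z k)) (z (k + 1)).fst‖
        ≤ √(lamMin H₁ H₂) / σ k * t → ‖sigmaSqrt H₁ H₂ (a k - z k)‖ ≤ t := by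
  choose a hstep hclose using fun k => hz.exists_displacement hD hH₁ hH₂ (hσ k)
  exact ⟨a, ⟨hσ, hstep, fun k => hclose k _ (hε k) (hz.critA k)⟩, hclose⟩

end IsIterates

theorem ErrorBound.hasErrorBound {κ r : ℝ} (hκ : 0 ≤ κ) (h : ErrorBound P κ r) :
    HasErrorBound P.Tl κ r := fun x g hx hg => by
  have hle : ENNReal.ofReal (Metric.infDist x P.Lam) ≤ ENNReal.ofReal κ * edist 0 g :=
    (h x hx).trans (mul_le_mul_right (Metric.infEDist_le_edist_of_mem hg) _)
  rw [edist_dist, dist_zero_left, ← ENNReal.ofReal_mul hκ] at hle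
  exact (ENNReal.ofReal_le_ofReal_iff (by positivity)).1 hle

namespace IsIterates

theorem exists_tendsto (hz : IsIterates P H₁ H₂ σ ε z) (hD : IsClosedConvex P.D)
    (hH₁ : H₁.PosDef) (hH₂ : H₂.PosDef) (hε : ∀ k, 0 ≤ ε k) (hεs : Summable ε) {c : ℝ}
    (hc : 0 < c) (hσ : ∀ k, c ≤ σ k) (hne : P.Lam.Nonempty) :
    ∃ w ∈ P.Lam, Tendsto z atTop (𝓝 w) := by
  obtain ⟨a, hppa, -⟩ := hz.exists_isInexactPPA hD hH₁ hH₂ (fun k => hc.trans_le (hσ k)) hε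
  exact hppa.exists_tendsto (Data.isMaximalMonotone_Tl hD) hεs (sigmaSqrt_injective hH₁ hH₂) hc hσ
    hne

theorem distSig_succ_le_mu_mul (hz : IsIterates P H₁ H₂ σ ε z) (hD : IsClosedConvex P.D)
    (hH₁ : H₁.PosDef) (hH₂ : H₂.PosDef) (hε : ∀ k, 0 ≤ ε k) (hεs : Summable ε)
    (hσ : ∀ k, 0 < σ k) (hne : P.Lam.Nonempty) {κ : ℝ} (hκ : 0 < κ)
    (hEB : ErrorBound P κ (∑' k, ε k + distSig H₁ H₂ (z 0) P.Lam)) {δ : ℕ → ℝ}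
    (hδ : ∀ k, δ k ∈ Set.Ico 0 1) (hB : CritB P H₁ H₂ σ δ z) (k : ℕ) :
    distSig H₁ H₂ (z (k + 1)) P.Lam
      ≤ mu κ (lamMax H₁ H₂) (σ k) (δ k) * distSig H₁ H₂ (z k) P.Lam := by
  obtain ⟨a, hppa, hclose⟩ := hz.exists_isInexactPPA hD hH₁ hH₂ hσ hε
  have hdisp : ‖sigmaSqrt H₁ H₂ (a k - z k)‖ ≤ δ k * ‖sigmaSqrt H₁ H₂ (z (k + 1) - z k)‖ := by
    refine hclose k _ (mul_nonneg (hδ k).1 (norm_nonneg _)) ((hB k).trans_eq ?_)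
    rw [normSig_eq hH₁.posSemidef hH₂.posSemidef]
    ring
  have hdist := distSig_eq (d := d) hH₁.posSemidef hH₂.posSemidef
  rw [hdist] at hEB ⊢
  rw [hdist]
  exact hppa.infDist_succ_le_mu_mul (Data.isMaximalMonotone_Tl hD) hεs hne hκ
    (hEB.hasErrorBound hκ.le) one_le_lamMax
    (norm_sigmaSqrt_le hH₁.posSemidef hH₂.posSemidef) (hδ k) hdisp

end IsIterates

end Iterates

section Rates

variable {κ lam : ℝ}

theorem tendsto_inv_sqrt_sq_add {ι : Type*} {l : Filter ι} {σ : ι → ℝ} {σinf : EReal}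
    (hbot : σinf ≠ ⊥) (hσ : Tendsto (fun k => (σ k : EReal)) l (𝓝 σinf)) {c : ℝ} (hc : 0 < c) :
    Tendsto (fun k => (√(σ k ^ 2 + c))⁻¹) l
      (𝓝 (if σinf = ⊤ then 0 else (√(σinf.toReal ^ 2 + c))⁻¹)) := by
  split_ifs with htop
  · rw [htop] at hσ
    refine tendsto_inv_atTop_zero.comp
      (tendsto_atTop_mono (fun k => ?_) (EReal.tendsto_coe_nhds_top_iff.1 hσ))
    exact Real.le_sqrt_of_sq_le (le_add_of_nonneg_right hc.le)
  · lift σinf to ℝ using ⟨htop, hbot⟩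
    rw [EReal.toReal_coe]
    exact ((((EReal.tendsto_coe.1 hσ).pow 2).add_const _).sqrt).inv₀ (by positivity)

theorem tendsto_mu (hκ : 0 < κ) (hlam : 0 < lam) {σ δ : ℕ → ℝ} {σinf : EReal} (hbot : σinf ≠ ⊥)
    (hσ : Tendsto (fun k => (σ k : EReal)) atTop (𝓝 σinf)) (hδ : Tendsto δ atTop (𝓝 0)) :
    Tendsto (fun k => mu κ lam (σ k) (δ k)) atTop (𝓝 (muInf κ lam σinf)) := by
  have hinv : Tendsto (fun k => 1 / (1 - δ k)) atTop (𝓝 1) := by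
    simpa using (hδ.const_sub 1).inv₀ (by norm_num)
  have hval : muInf κ lam σinf = 1 * (0 + (1 + 0) * κ * lam
      * if σinf = ⊤ then 0 else (√(σinf.toReal ^ 2 + κ ^ 2 * lam ^ 2))⁻¹) := by
    rw [muInf]
    split_ifs <;> ring
  rw [hval]
  exact hinv.mul (hδ.add ((((hδ.const_add 1).mul_const κ).mul_const lam).mul
    (tendsto_inv_sqrt_sq_add hbot hσ (mul_pos (pow_pos hκ 2) (pow_pos hlam 2)))))

theorem muInf_lt_one (hκ : 0 < κ) (hlam : 0 < lam) {σinf : EReal} (h : 0 < σinf) :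
    muInf κ lam σinf < 1 := by
  rw [muInf]
  split_ifs with htop
  · exact one_pos
  · have hpos : 0 < σinf.toReal := EReal.toReal_pos h htop
    rw [div_lt_one (by positivity), ← mul_pow]
    exact Real.lt_sqrt_of_sq_lt (lt_add_of_pos_left _ (pow_pos hpos 2))

theorem tendsto_muInf (κ lam : ℝ) :
    Tendsto (fun s : ℝ => muInf κ lam (s : EReal)) atTop (𝓝 0) := by
  have hsqrt : Tendsto (fun s : ℝ => √(s ^ 2 + κ ^ 2 * lam ^ 2)) atTop atTop :=
    tendsto_atTop_mono (fun s => Real.le_sqrt_of_sq_le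
      (le_add_of_nonneg_right (by positivity))) tendsto_id
  simpa [muInf] using hsqrt.const_div_atTop (κ * lam)

end Rates

end ProxALM

end

theorem theorem2_general {n d : ℕ} (P : ProxALM.Data n d)
    (hDne : P.D.Nonempty) (hDcl : IsClosed P.D) (hDcv : Convex ℝ P.D)
    (H₁ : Matrix (Fin n) (Fin n) ℝ) (H₂ : Matrix (Fin n × Fin d) (Fin n × Fin d) ℝ)
    (hH₁ : H₁.PosDef) (hH₂ : H₂.PosDef)
    (ε : ℕ → ℝ) (hε : ∀ k, 0 ≤ ε k) (hεs : Summable ε)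
    (σ : ℕ → ℝ) (c : ℝ) (hc : 0 < c) (hσ : ∀ k, c ≤ σ k)
    (σinf : EReal) (hσlim : Tendsto (fun k => (σ k : EReal)) atTop (𝓝 σinf))
    (z : ℕ → ProxALM.PD n d) (hz : ProxALM.IsIterates P H₁ H₂ σ ε z)
    (hkkt : P.kktSet.Nonempty) :
    P.kktSet = P.Lam ∧
    (Bornology.IsBounded (Set.range z) ∧
      (∃ x, P.IsPrimalOptimal x ∧ Tendsto (fun k => (z k).fst) atTop (𝓝 x)) ∧
      (∃ y, P.IsDualOptimal y ∧ Tendsto (fun k => (z k).snd) atTop (𝓝 y))) ∧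
    (∀ κ : ℝ, 0 < κ →
      ProxALM.ErrorBound P κ ((∑' k, ε k) + ProxALM.distSig H₁ H₂ (z 0) P.Lam) →
      ∀ δ : ℕ → ℝ, (∀ k, 0 ≤ δ k ∧ δ k < 1) → Tendsto δ atTop (𝓝 0) →
      ProxALM.CritB P H₁ H₂ σ δ z →
      (∀ k, ProxALM.distSig H₁ H₂ (z (k + 1)) P.Lam
        ≤ ProxALM.mu κ (ProxALM.lamMax H₁ H₂) (σ k) (δ k)
          * ProxALM.distSig H₁ H₂ (z k) P.Lam) ∧
      Tendsto (fun k => ProxALM.mu κ (ProxALM.lamMax H₁ H₂) (σ k) (δ k)) atTop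
        (𝓝 (ProxALM.muInf κ (ProxALM.lamMax H₁ H₂) σinf)) ∧
      ProxALM.muInf κ (ProxALM.lamMax H₁ H₂) σinf < 1 ∧
      Tendsto (fun s : ℝ => ProxALM.muInf κ (ProxALM.lamMax H₁ H₂) (s : EReal)) atTop
        (𝓝 0)) := by
  have hD : ProxALM.IsClosedConvex P.D := ⟨hDne, hDcl, hDcv⟩
  have hLam : P.kktSet = P.Lam := ProxALM.Data.kktSet_eq_Lam hD
  have hne : P.Lam.Nonempty := hLam ▸ hkkt
  have hσinf : 0 < σinf := (EReal.coe_pos.2 hc).trans_le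
    (ge_of_tendsto' hσlim fun k => EReal.coe_le_coe_iff.2 (hσ k))
  have hlam : 0 < ProxALM.lamMax H₁ H₂ := one_pos.trans_le ProxALM.one_le_lamMax
  obtain ⟨w, hw, hlim⟩ := hz.exists_tendsto hD hH₁ hH₂ hε hεs hc hσ hne
  refine ⟨hLam, ⟨Metric.isBounded_range_of_tendsto z hlim,
    ⟨w.fst, ProxALM.Data.isPrimalOptimal_of_mem_Lam hD hw,
      ((by fun_prop : Continuous fun z : ProxALM.PD n d => z.fst).tendsto w).comp hlim⟩,
    ⟨w.snd, ProxALM.Data.isDualOptimal_of_mem_Lam hD hw,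
      ((by fun_prop : Continuous fun z : ProxALM.PD n d => z.snd).tendsto w).comp hlim⟩⟩,
    fun κ hκ hEB δ hδ hδ₀ hB => ⟨?_, ?_, ?_, ?_⟩⟩
  · exact hz.distSig_succ_le_mu_mul hD hH₁ hH₂ hε hεs (fun k => hc.trans_le (hσ k)) hne hκ hEB hδ hB
  · exact ProxALM.tendsto_mu hκ hlam (bot_le.trans_lt hσinf).ne' hσlim hδ₀
  · exact ProxALM.muInf_lt_one hκ hlam hσinf
  · exact ProxALM.tendsto_muInf κ _

theorem theorem2 {n d : ℕ} (P : ProxALM.Data n d)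
    (hDne : P.D.Nonempty) (hDcl : IsClosed P.D) (hDcv : Convex ℝ P.D)
    (H₁ : Matrix (Fin n) (Fin n) ℝ) (H₂ : Matrix (Fin n × Fin d) (Fin n × Fin d) ℝ)
    (hH₁ : H₁.PosDef) (hH₂ : H₂.PosDef)
    (ε : ℕ → ℝ) (hε : ∀ k, 0 ≤ ε k) (hεs : Summable ε)
    (σ : ℕ → ℝ) (hσ0 : 0 < σ 0) (hσm : Monotone σ)
    (σinf : EReal) (hσlim : Tendsto (fun k => (σ k : EReal)) atTop (𝓝 σinf))
    (z : ℕ → ProxALM.PD n d) (hz : ProxALM.IsIterates P H₁ H₂ σ ε z)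
    (hkkt : P.kktSet.Nonempty) :
    P.kktSet = P.Lam ∧
    (Bornology.IsBounded (Set.range z) ∧
      (∃ x, P.IsPrimalOptimal x ∧ Tendsto (fun k => (z k).fst) atTop (𝓝 x)) ∧
      (∃ y, P.IsDualOptimal y ∧ Tendsto (fun k => (z k).snd) atTop (𝓝 y))) ∧
    (∀ κ : ℝ, 0 < κ →
      ProxALM.ErrorBound P κ ((∑' k, ε k) + ProxALM.distSig H₁ H₂ (z 0) P.Lam) →
      ∀ δ : ℕ → ℝ, (∀ k, 0 ≤ δ k ∧ δ k < 1) → Summable δ →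
      ProxALM.CritB P H₁ H₂ σ δ z →
      (∀ k, ProxALM.distSig H₁ H₂ (z (k + 1)) P.Lam
        ≤ ProxALM.mu κ (ProxALM.lamMax H₁ H₂) (σ k) (δ k)
          * ProxALM.distSig H₁ H₂ (z k) P.Lam) ∧
      Tendsto (fun k => ProxALM.mu κ (ProxALM.lamMax H₁ H₂) (σ k) (δ k)) atTop
        (𝓝 (ProxALM.muInf κ (ProxALM.lamMax H₁ H₂) σinf)) ∧
      ProxALM.muInf κ (ProxALM.lamMax H₁ H₂) σinf < 1 ∧
      Tendsto (fun s : ℝ => ProxALM.muInf κ (ProxALM.lamMax H₁ H₂) (s : EReal)) atTop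
        (𝓝 0)) := by
  obtain ⟨hLam, hconv, hrate⟩ := theorem2_general P hDne hDcl hDcv H₁ H₂ hH₁ hH₂ ε hε hεs σ (σ 0)
    hσ0 (fun k => hσm (Nat.zero_le k)) σinf hσlim z hz hkkt
  exact ⟨hLam, hconv, fun κ hκ hEB δ hδ hδs => hrate κ hκ hEB δ hδ hδs.tendsto_atTop_zero⟩
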